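/- Let $r\ge 2$ and $n_{\mathrm{cp}}\ge 0$ be integers with $n_{\mathrm{cp}}<r-1$. \textbf{The scheme.} On a uniform mesh with cells $I_j$ of centre $x_j$ and size $h=\Delta x$, for $s=0,\dots,r-1$ let $p_s$ be the polynomial of degree $<r$ that has the given cell averages $\bar u_{j+s-r+1},\dots,\bar u_{j+s}$ on the cells of the substencil $S_s=\{I_{j+s-r+1},\dots,I_{j+s}\}$; put $u^s_{j+1/2}=p_s(x_{j+1/2})$ and $\beta_s=\sum_{l=1}^{r-1}h^{2l-1}\int_{I_j}(p_s^{(l)}(x))^2\,dx$. Let $d_0,\dots,d_{r-1}$ be the ideal weights, $d_s=\binom rs\binom{r-1}s/\binom{2r-1}r$, i.e. the weights for which $\sum_s d_su^s_{j+1/2}$ is the $(2r-1)$th-order reconstruction on the stencil $\{I_{j-r+1},\dots,I_{j+r-1}\}$. For $\epsilon>0$ the WENO-JS weights are $\omega_s=\alpha_s/\sum_l\alpha_l$ with $\alpha_s=d_s/(\epsilon+\beta_s)^2$. Fix parameters $k\in\mathbb N$, $A,\delta,\epsilon_A>0$ and $m_0,\dots,m_{r-1}>0$, let $$\mathrm{sgm}(x)=\begin{cases}x/|x|,&|x|\ge\delta,\\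 x/\big((\delta^2-x^2)^{k+3}+|x|\big),&|x|<\delta,\end{cases}\qquad \Lambda_d(\omega)=A\Big(\tfrac{1+(-1)^k}{2}+\tfrac{1+(-1)^{k+1}}{2}\,\mathrm{sgm}(\omega-d)\Big),$$ $$g(\omega;d,m)=d+\frac{\Lambda_d(\omega)(\omega-d)^{k+1}}{\Lambda_d(\omega)(\omega-d)^k+\omega^{\frac{d}{m\omega+\epsilon_A}}(1-\omega)^{\frac{1-d}{m(1-\omega)+\epsilon_A}}},$$ and $G(\omega)=g(\omega;d_{k^*},m_{k^*})$, where $k^*$ is the smallest index $i$ minimizing $|\omega-d_i|$. The $(2r-1)$th-order MOP-WENO-MAIM1 reconstruction is $u^-_{j+1/2}=\sum_s\frac{G(\omega_s)}{\sum_lG(\omega_l)}u^s_{j+1/2}$; $u^+_{j+1/2}$ is obtained by mirror symmetry with respect to $x_{j+1/2}$. With the Lax--Friedrichs flux $\hat f_{j+1/2}=\frac12\big[f(u^-_{j+1/2})+f(u^+_{j+1/2})-\alpha(u^+_{j+1/2}-u^-_{j+1/2})\big]$, where $\alpha$ is a real constant (for instance $\max|f'|$), the spatial operator is $\mathcal L_j=-\frac1h(\hat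 f_{j+1/2}-\hat f_{j-1/2})$. \textbf{The claim.} Let $$c=\Big\lceil\frac{r}{r-1-n_{\mathrm{cp}}}-2\Big\rceil,\qquad k^{\mathrm{MAIM}}=c+\frac{1+(-1)^{c}}2,$$ and suppose $k\ge k^{\mathrm{MAIM}}$. Let $u$ be a $C^\infty$ solution of $u_t+f(u)_x=0$ near $(t_0,x_0)$, with $f$ of class $C^2$ at $u(t_0,x_0)$, and suppose that $x_0$ is a critical point of order $n_{\mathrm{cp}}$ of $u(t_0,\cdot)$: $\partial_x^lu(t_0,x_0)=0$ for $1\le l\le n_{\mathrm{cp}}$ and $\partial_x^{n_{\mathrm{cp}}+1}u(t_0,x_0)\ne0$ (for $n_{\mathrm{cp}}=0$: $\partial_xu(t_0,x_0)\neq 0$). Then the scheme has the optimal order of accuracy $2r-1$ at and near $x_0$. That is, there are constants $C$ and $h_0,\rho>0$ such that for all $0<h<h_0$, all $\epsilon>0$ and every cell with centre $x_j\in(x_0-\rho,x_0+\rho)$, the scheme applied to the exact cell averages of $u(t_0,\cdot)$ satisfies $$|u^\pm_{j+1/2}-u(t_0,x_{j+1/2})|\le Ch^{2r-1},\qquad \Big|\frac{d}{dt}\Big|_{t=t_0}\bar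 u(t,x_j)-\mathcal L_j\Big|\le Ch^{2r-1},\qquad \bar u(t,x_j)=\frac1h\int_{x_j-h/2}^{x_j+h/2}u(t,y)\,dy$$ -/

import Mathlib

open Polynomial Finset Topology

noncomputable section

namespace MOPWENO

/-! ### Reconstruction from cell averages

All reconstructions are scale free and are written in the unit-cell coordinate
`ξ = (x - x_j) / Δx` attached to the centre `x_j` of a cell `I_j`.  In it, the cell `I_{j+i}` is
`[i - 1/2, i + 1/2]` and the right interface `x_{j+1/2}` is `ξ = 1/2`.  The data is the family
`v : ℤ → ℝ` of cell averages, `v i` being the cell average on `I_{j+i}`. -/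

/-- The polynomial of degree `< n` whose cell averages on the `n` consecutive cells
`a, a + 1, …, a + n - 1` are `v a, …, v (a + n - 1)`: the derivative of the polynomial that
interpolates the primitive of the data at the `n + 1` interfaces of these cells. -/
def reconPoly (a : ℤ) (n : ℕ) (v : ℤ → ℝ) : ℝ[X] :=
  derivative (Lagrange.interpolate (range (n + 1)) (fun q : ℕ => (a : ℝ) - 1 / 2 + q)
    (fun q : ℕ => ∑ i ∈ range q, v (a + i)))

/-- The reconstruction polynomial on the substencil `S_s = {I_{j+s-r+1}, …, I_{j+s}}`. -/
def subPoly (r s : ℕ) (v : ℤ → ℝ) : ℝ[X] := reconPoly ((s : ℤ) - ((r : ℤ) - 1)) r v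

/-- The approximation `u^s_{j+1/2}` of the interface value given by the substencil `S_s`. -/
def subRecon (r s : ℕ) (v : ℤ → ℝ) : ℝ := (subPoly r s v).eval (1 / 2)

/-- The approximation of the interface value given by the whole `(2r-1)`-cell stencil
`{I_{j-r+1}, …, I_{j+r-1}}`: the central upstream scheme of order `2r - 1`. -/
def fullRecon (r : ℕ) (v : ℤ → ℝ) : ℝ :=
  (reconPoly (-((r : ℤ) - 1)) (2 * r - 1) v).eval (1 / 2)

/-- The ideal (optimal) weights `d_0, …, d_{r-1}`; for `r = 3` they are `1/10, 6/10, 3/10`.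
They are the weights that generate the `(2r-1)`th-order scheme of the whole stencil from the
substencils, see `sum_idealWeight_mul_subRecon`. -/
def idealWeight (r s : ℕ) : ℝ :=
  ((r.choose s : ℝ) * ((r - 1).choose s : ℝ)) / ((2 * r - 1).choose r : ℝ)

theorem prod_erase_sub (n m : ℕ) (hm : m ≤ n) :
    ∏ l ∈ (range (n + 1)).erase m, ((m : ℝ) - l)
      = (m.factorial : ℝ) * ((-1) ^ (n - m) * ((n - m).factorial : ℝ)) := by
  obtain ⟨b, rfl⟩ := Nat.exists_eq_add_of_le hm
  have h0 : ∀ m : ℕ, ∏ l ∈ range m, ((m : ℝ) - l) = m.factorial := by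
    intro m
    rw [← Finset.prod_range_reflect, ← Finset.prod_range_add_one_eq_factorial]
    push_cast
    refine Finset.prod_congr rfl fun i hi => ?_
    have := Finset.mem_range.1 hi
    rw [Nat.cast_sub (by omega), Nat.cast_sub (by omega)]
    push_cast; ring
  have h1 : (range (m + b + 1)).erase m = range m ∪ (Finset.Ico (m + 1) (m + b + 1)) := by
    ext x; simp; omega
  have hd : Disjoint (range m) (Finset.Ico (m + 1) (m + b + 1)) := by
    rw [Finset.disjoint_left]; intro x; simp; omega
  rw [h1, Finset.prod_union hd, h0, Finset.prod_Ico_eq_prod_range]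
  congr 1
  have : m + b + 1 - (m + 1) = b := by omega
  rw [this, Nat.add_sub_cancel_left, ← Finset.prod_range_add_one_eq_factorial]
  push_cast
  rw [show ((-1 : ℝ)) ^ b = ∏ _i ∈ range b, (-1 : ℝ) by simp, ← Finset.prod_mul_distrib]
  refine Finset.prod_congr rfl fun i _ => ?_
  ring

/-- The value at an interface of the reconstruction polynomial. -/
theorem eval_reconPoly (a : ℤ) (n p : ℕ) (hp : p ≤ n) (v : ℤ → ℝ) (W : ℕ → ℝ)
    (hW : ∀ q ≤ n, ∑ i ∈ range q, v (a + i) = W q - W 0) :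
    (reconPoly a n v).eval ((a : ℝ) - 1 / 2 + p)
      = ∑ q ∈ (range (n + 1)).erase p,
          (-1) ^ (p + q) * ((p.factorial : ℝ) * (n - p).factorial)
            / ((q.factorial : ℝ) * (n - q).factorial) / ((p : ℝ) - q) * (W q - W p) := by
  set s := range (n + 1)
  set x : ℕ → ℝ := fun q => (a : ℝ) - 1 / 2 + q
  have hx : Set.InjOn x s := by
    intro i _ j _ h
    simpa [x] using h
  have hps : p ∈ s := by simp [s]; omega
  -- subtract a constant
  have h1 : Lagrange.interpolate s x (fun q : ℕ => ∑ i ∈ range q, v (a + i))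
      = Lagrange.interpolate s x (fun q => W q - W p) + C (W p - W 0) := by
    have hc : Lagrange.interpolate s x (fun _ => W p - W 0) = C (W p - W 0) := by
      have := Lagrange.interpolate_one (s := s) (v := x) hx ⟨p, hps⟩
      have h2 := (Lagrange.interpolate s x).map_smul (W p - W 0) 1
      rw [this] at h2
      rw [Polynomial.smul_eq_C_mul, mul_one] at h2
      rw [← h2]
      congr 1
      ext; simp
    rw [← hc, ← map_add]
    apply Lagrange.interpolate_eq_of_values_eq_on
    intro q hq
    have : q ≤ n := by simp [s] at hq; omega
    rw [hW q this]; simp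
  have key : ∀ q ∈ s.erase p, (derivative (Lagrange.basis s x q)).eval (x p)
      = (-1) ^ (p + q) * ((p.factorial : ℝ) * (n - p).factorial)
            / ((q.factorial : ℝ) * (n - q).factorial) / ((p : ℝ) - q) := by
    intro q hq
    have hqp : q ≠ p := Finset.ne_of_mem_erase hq
    have hqs : q ∈ s := Finset.mem_of_mem_erase hq
    have hqn : q ≤ n := by simp [s] at hqs; omega
    have hpq : p ∈ s.erase q := Finset.mem_erase.2 ⟨hqp.symm, hps⟩
    have hw : ∀ i ∈ s, Lagrange.nodalWeight s x i
        = ((i.factorial : ℝ) * ((-1) ^ (n - i) * ((n - i).factorial : ℝ)))⁻¹ := by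
      intro i hi
      have : i ≤ n := by simp [s] at hi; omega
      rw [← prod_erase_sub n i this, Lagrange.nodalWeight, Finset.prod_inv_distrib]
      congr 1
      refine Finset.prod_congr rfl fun l _ => ?_
      simp [x]
    have hb : Lagrange.basis s x q
        = C (Lagrange.nodalWeight s x q) * Lagrange.nodal (s.erase q) x := by
      rw [Lagrange.basis, Lagrange.nodalWeight, Lagrange.nodal, map_prod,
        ← Finset.prod_mul_distrib]
      rfl
    have hn : (derivative (Lagrange.nodal (s.erase q) x)).eval (x p)
        = (Lagrange.nodalWeight s x p)⁻¹ / ((p : ℝ) - q) := by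
      rw [Lagrange.eval_nodal_derivative_eval_node_eq hpq,
        Lagrange.nodalWeight_eq_eval_nodal_erase_inv, inv_inv]
      have hq' : q ∈ s.erase p := hq
      rw [Lagrange.eval_nodal, Lagrange.eval_nodal, Finset.erase_right_comm,
        ← Finset.mul_prod_erase (s.erase p) _ hq']
      have : x p - x q = (p : ℝ) - q := by simp [x]
      have h0 : (p : ℝ) - q ≠ 0 := by
        rw [sub_ne_zero]; exact_mod_cast hqp.symm
      rw [this, mul_div_cancel_left₀ _ h0]
    rw [hb, derivative_C_mul, eval_C_mul, hn, hw p hps, hw q hqs, inv_inv]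
    have e : ((-1 : ℝ)) ^ (p + q) = (-1) ^ (n - p) * (-1) ^ (n - q) := by
      have h3 : p + q + ((n - p) + (n - q)) = 2 * n := by omega
      have h4 : ((-1 : ℝ)) ^ (p + q) * (-1) ^ ((n - p) + (n - q)) = 1 := by
        rw [← pow_add, h3]; simp
      rw [← pow_add]
      rcases neg_one_pow_eq_or ℝ ((n - p) + (n - q)) with h5 | h5 <;> rw [h5] at h4 ⊢ <;> linarith
    have h0 : (p : ℝ) - q ≠ 0 := by
      rw [sub_ne_zero]; exact_mod_cast hqp.symm
    rw [e]
    have f1 : (q.factorial : ℝ) ≠ 0 := by positivity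
    have f2 : ((n - q).factorial : ℝ) ≠ 0 := by positivity
    rcases neg_one_pow_eq_or ℝ (n - q) with h5 | h5 <;>
    rcases neg_one_pow_eq_or ℝ (n - p) with h6 | h6 <;> rw [h5, h6] <;> field_simp
  have hxp : (a : ℝ) - 1 / 2 + p = x p := rfl
  rw [reconPoly, hxp]
  change eval (x p) (derivative (Lagrange.interpolate s x _)) = _
  rw [h1, derivative_add, derivative_C, add_zero, Lagrange.interpolate_apply, derivative_sum,
    eval_finsetSum, ← Finset.add_sum_erase _ _ hps]
  simp only [derivative_C_mul, eval_C_mul, sub_self, zero_mul, zero_add]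
  refine Finset.sum_congr rfl fun q hq => ?_
  rw [key q hq, mul_comm]

/-- The ideal weights generate the `(2r-1)`th-order scheme of the whole stencil. -/
theorem sum_idealWeight_mul_subRecon (r : ℕ) (hr : 1 ≤ r) (v : ℤ → ℝ) :
    ∑ s ∈ range r, idealWeight r s * subRecon r s v = fullRecon r v := by
  set W : ℕ → ℝ := fun q => ∑ i ∈ range q, v (-((r : ℤ) - 1) + i) with hWdef
  have hfull : fullRecon r v = ∑ q ∈ (range (2 * r)).erase r,
      (-1) ^ (r + q) * ((r.factorial : ℝ) * (r - 1).factorial)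
        / ((q.factorial : ℝ) * (2 * r - 1 - q).factorial) / ((r : ℝ) - q) * (W q - W r) := by
    have h := eval_reconPoly (-((r : ℤ) - 1)) (2 * r - 1) r (by omega) v W
      (by intro q _; simp [hWdef])
    have e1 : (((-((r : ℤ) - 1) : ℤ)) : ℝ) - 1 / 2 + r = 1 / 2 := by push_cast; ring
    have e2 : 2 * r - 1 + 1 = 2 * r := by omega
    have e3 : 2 * r - 1 - r = r - 1 := by omega
    rw [e1, e2, e3] at h
    exact h
  have hsub : ∀ s ∈ range r, subRecon r s v = ∑ M ∈ (range (2 * r)).erase r,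
      (if s ≤ M ∧ M ≤ s + r then (-1) ^ (r + M) * (((r - s).factorial : ℝ) * s.factorial)
        / (((M - s).factorial : ℝ) * (r - (M - s)).factorial) / ((r : ℝ) - M) * (W M - W r)
        else 0) := by
    intro s hs
    have hs : s < r := Finset.mem_range.1 hs
    have h := eval_reconPoly ((s : ℤ) - ((r : ℤ) - 1)) r (r - s) (by omega) v
      (fun q => W (q + s)) (by
        intro q _
        simp only [hWdef, zero_add]
        rw [add_comm q s, Finset.sum_range_add, add_sub_cancel_left]
        refine Finset.sum_congr rfl fun i _ => ?_
        congr 1; push_cast; ring)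
    have e1 : ((((s : ℤ) - ((r : ℤ) - 1) : ℤ)) : ℝ) - 1 / 2 + ((r - s : ℕ) : ℝ) = 1 / 2 := by
      rw [Nat.cast_sub hs.le]; push_cast; ring
    rw [e1] at h
    rw [subRecon, subPoly, h, ← Finset.sum_filter]
    refine Finset.sum_bij' (fun q _ => q + s) (fun M _ => M - s) ?_ ?_ ?_ ?_ ?_
    · intro q; simp; omega
    · intro q; simp; omega
    · intro q; simp
    · intro q; simp; omega
    · intro q hq
      have e2 : r - (r - s) = s := by omega
      have e3 : r - s + s = r := by omega
      have e4 : ((-1 : ℝ)) ^ (r - s + q) = (-1) ^ (r + (q + s)) := by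
        rw [show r + (q + s) = (r - s + q) + 2 * s by omega, pow_add _ _ (2 * s)]; simp
      simp only [e2, e3, e4, Nat.add_sub_cancel]
      rw [Nat.cast_sub hs.le]
      push_cast
      congr 2
      ring
  rw [hfull, Finset.sum_congr rfl fun s hs => by rw [hsub s hs, Finset.mul_sum], Finset.sum_comm]
  refine Finset.sum_congr rfl fun M hM => ?_
  have hM2 : M < 2 * r := by simpa using (Finset.mem_of_mem_erase hM)
  have hv : ∑ s ∈ range r, ((r - 1).choose s : ℝ)
      * (if s ≤ M ∧ M ≤ s + r then (r.choose (M - s) : ℝ) else 0) = (2 * r - 1).choose M := by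
    have h := Nat.add_choose_eq (r - 1) r M
    rw [Finset.Nat.sum_antidiagonal_eq_sum_range_succ_mk] at h
    rw [show 2 * r - 1 = r - 1 + r by omega, h]
    push_cast
    have hsplit : ∀ s, ((r - 1).choose s : ℝ)
        * (if s ≤ M ∧ M ≤ s + r then (r.choose (M - s) : ℝ) else 0)
        = if s ∈ range (M + 1) then ((r - 1).choose s : ℝ) * (r.choose (M - s) : ℝ) else 0 := by
      intro s
      by_cases h1 : s ≤ M
      · by_cases h2 : M ≤ s + r
        · simp [h1, h2, Nat.lt_succ_of_le h1]
        · simp [h1, h2, Nat.lt_succ_of_le h1, Nat.choose_eq_zero_of_lt (show r < M - s by omega)]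
      · simp [h1]
    simp only [hsplit]
    rw [Finset.sum_ite_mem]
    refine Finset.sum_subset Finset.inter_subset_right ?_
    intro s hs hs'
    have : r - 1 < s := by
      simp only [Finset.mem_inter, Finset.mem_range] at hs hs'
      omega
    simp [Nat.choose_eq_zero_of_lt this]
  have hterm : ∀ s ∈ range r, idealWeight r s *
      (if s ≤ M ∧ M ≤ s + r then (-1) ^ (r + M) * (((r - s).factorial : ℝ) * s.factorial)
        / (((M - s).factorial : ℝ) * (r - (M - s)).factorial) / ((r : ℝ) - M) * (W M - W r)
        else 0)
      = ((-1) ^ (r + M) / ((r : ℝ) - M) * (W M - W r) / ((2 * r - 1).choose r : ℝ)) *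
        (((r - 1).choose s : ℝ)
      * (if s ≤ M ∧ M ≤ s + r then (r.choose (M - s) : ℝ) else 0)) := by
    intro s hs
    have hs : s < r := Finset.mem_range.1 hs
    split_ifs with h
    · rw [idealWeight, Nat.cast_choose ℝ (show M - s ≤ r by omega), Nat.cast_choose ℝ hs.le]
      field_simp
    · simp
  rw [Finset.sum_congr rfl hterm, ← Finset.mul_sum, hv, Nat.cast_choose ℝ (show M ≤ 2 * r - 1 by omega),
    Nat.cast_choose ℝ (show r ≤ 2 * r - 1 by omega), show 2 * r - 1 - r = r - 1 by omega]
  field_simp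


/-! ### The WENO-JS weights -/

/-- The Jiang–Shu smoothness indicator
`β_s = ∑_{l=1}^{r-1} Δx^{2l-1} ∫_{I_j} (p_s^{(l)}(x))² dx`, in the unit-cell coordinate. -/
def smoothness (r s : ℕ) (v : ℤ → ℝ) : ℝ :=
  ∑ l ∈ Icc 1 (r - 1),
    ∫ ξ in (-(1 / 2) : ℝ)..(1 / 2), ((derivative^[l] (subPoly r s v)).eval ξ) ^ 2

/-- The unnormalized WENO-JS weight `α_s^{JS} = d_s / (ε + β_s)²`. -/
def jsAlpha (r : ℕ) (ε : ℝ) (v : ℤ → ℝ) (s : ℕ) : ℝ :=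
  idealWeight r s / (ε + smoothness r s v) ^ 2

/-- The WENO-JS weight `ω_s^{JS}`. -/
def jsWeight (r : ℕ) (ε : ℝ) (v : ℤ → ℝ) (s : ℕ) : ℝ :=
  jsAlpha r ε v s / ∑ l ∈ range r, jsAlpha r ε v l

/-! ### The mapping functions -/

/-- The function `sgm(x, δ, B, k)`. -/
def sgm (x δ B : ℝ) (k : ℕ) : ℝ :=
  if δ ≤ |x| then x / |x| else x / ((B * (δ ^ 2 - x ^ 2)) ^ (k + 3) + |x|)

/-- The parameters of the WENO-MAIM1 mapping functions; `m s` is `m_s`. -/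
structure MAIMParams where
  k : ℕ
  A : ℝ
  δ : ℝ
  εA : ℝ
  m : ℕ → ℝ

/-- The factor `A ((1 + (-1)^k) / 2 + (1 + (-1)^{k+1}) / 2 · sgm(ω - d, δ, 1, k))`. -/
def maimFactor (P : MAIMParams) (d ω : ℝ) : ℝ :=
  P.A * ((1 + (-1) ^ P.k) / 2 + (1 + (-1) ^ (P.k + 1)) / 2 * sgm (ω - d) P.δ 1 P.k)

/-- The WENO-MAIM1 mapping function `g(ω; d, m)`, as a function of the two parameters
`d = d_s`, `m = m_s` that depend on the substencil. -/
def maimMap (P : MAIMParams) (d m ω : ℝ) : ℝ :=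
  d + maimFactor P d ω * (ω - d) ^ (P.k + 1) /
    (maimFactor P d ω * (ω - d) ^ P.k +
      ω ^ (d / (m * ω + P.εA)) * (1 - ω) ^ ((1 - d) / (m * (1 - ω) + P.εA)))

/-- The smallest index `k* ∈ {0, …, r-1}` at which `|ω - d_i|` is minimal. -/
def minDistIndex (r : ℕ) (d : ℕ → ℝ) (ω : ℝ) : ℕ :=
  sInf {k | k < r ∧ ∀ i < r, |ω - d k| ≤ |ω - d i|}

/-- `minDist(x_0, …, x_{r-1}; d_0, …, d_{r-1}; ω) = x_{k*}`. -/
def minDist (r : ℕ) (x d : ℕ → ℝ) (ω : ℝ) : ℝ := x (minDistIndex r d ω)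

/-- The order-preserving mapping function of MOP-WENO-MAIM1: the substencil-dependent parameters
of the WENO-MAIM1 mapping function are replaced by those selected by `minDist`. -/
def mopMap (r : ℕ) (P : MAIMParams) (ω : ℝ) : ℝ :=
  maimMap P (minDist r (idealWeight r) (idealWeight r) ω) (minDist r P.m (idealWeight r) ω) ω

/-- The MOP-WENO-MAIM1 weight `ω_s^{MOP-MAIM1}`. -/
def mopWeight (r : ℕ) (P : MAIMParams) (ε : ℝ) (v : ℤ → ℝ) (s : ℕ) : ℝ :=
  mopMap r P (jsWeight r ε v s) / ∑ l ∈ range r, mopMap r P (jsWeight r ε v l)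

/-- The MOP-WENO-MAIM1 reconstruction at the right interface of the cell `0`, from the left. -/
def mopRecon (r : ℕ) (P : MAIMParams) (ε : ℝ) (v : ℤ → ℝ) : ℝ :=
  ∑ s ∈ range r, mopWeight r P ε v s * subRecon r s v

/-! ### The semi-discrete finite volume scheme -/

/-- The cell average of `w` over the cell of centre `x` and size `h`. -/
def cellAvg (w : ℝ → ℝ) (x h : ℝ) : ℝ := (1 / h) * ∫ y in (x - h / 2)..(x + h / 2), w y

/-- The left-biased value `u^-` at the right interface `x + h / 2` of the cell of centre `x` of
the uniform mesh of size `h`, reconstructed from the cell averages of `w`. -/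
def uMinus (r : ℕ) (P : MAIMParams) (ε : ℝ) (w : ℝ → ℝ) (x h : ℝ) : ℝ :=
  mopRecon r P ε (fun i => cellAvg w (x + (i : ℝ) * h) h)

/-- The right-biased value `u^+` at the right interface `x + h / 2` of the cell of centre `x`:
the mirror image of the left-biased procedure with respect to this interface, under which the
cell of centre `x + i h` goes to the cell of centre `x + (1 - i) h`. -/
def uPlus (r : ℕ) (P : MAIMParams) (ε : ℝ) (w : ℝ → ℝ) (x h : ℝ) : ℝ :=
  mopRecon r P ε (fun i => cellAvg w (x + (1 - (i : ℝ)) * h) h)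

/-- The Lax–Friedrichs flux with viscosity constant `α`. -/
def lfFlux (f : ℝ → ℝ) (α a b : ℝ) : ℝ := (1 / 2) * (f a + f b - α * (b - a))

/-- The numerical flux at the interface `x + h / 2`. -/
def numFlux (r : ℕ) (P : MAIMParams) (ε : ℝ) (f : ℝ → ℝ) (α : ℝ) (w : ℝ → ℝ) (x h : ℝ) : ℝ :=
  lfFlux f α (uMinus r P ε w x h) (uPlus r P ε w x h)

/-- The spatial operator `𝓛 = -(1/Δx) (f̂_{j+1/2} - f̂_{j-1/2})` of the `(2r-1)`th-order
MOP-WENO-MAIM1 scheme on the cell of centre `x`, applied to the exact cell averages of `w`. -/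
def spatialOp (r : ℕ) (P : MAIMParams) (ε : ℝ) (f : ℝ → ℝ) (α : ℝ) (w : ℝ → ℝ) (x h : ℝ) : ℝ :=
  -(1 / h) * (numFlux r P ε f α w x h - numFlux r P ε f α w (x - h) h)

/-! ### Critical points and the threshold -/

/-- `x₀` is a critical point of order `n` of `w`: the derivatives of orders `1, …, n` vanish at
`x₀` and the one of order `n + 1` does not (for `n = 0`, the point is not critical). -/
def IsCriticalPointOfOrder (n : ℕ) (w : ℝ → ℝ) (x₀ : ℝ) : Prop :=
  (∀ l, 1 ≤ l → l ≤ n → iteratedDeriv l w x₀ = 0) ∧ iteratedDeriv (n + 1) w x₀ ≠ 0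

/-- The integer `⌈r / (r - 1 - n_cp) - 2⌉`. -/
def maimCeil (r n : ℕ) : ℤ := ⌈(r : ℝ) / ((r : ℝ) - 1 - (n : ℝ)) - 2⌉

/-- The threshold `k^{MAIM}`. -/
def kMAIM (r n : ℕ) : ℝ := (maimCeil r n : ℝ) + (1 + (-1 : ℝ) ^ maimCeil r n) / 2

end MOPWENO

end

namespace MOPWENO

/-! Write `w = u t₀`, `p = r - 1 - n`, `q = maimOrder k`, and work with `φ ξ = w (y + τ ξ)`: `τ = h`
gives the left-biased value and `τ = -h` its mirror image, so one estimate in `t = |τ|` serves both.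

All substencil polynomials agree with the Taylor polynomial of degree `< r` of `φ`, derivatives
included, up to `O(t^r)`. The derivative of order `n + 1` makes each indicator at least of size
`t^(2(n+1))`. Since `2r = 2p + 2(n+1)`, Young's inequality with weight `t^p` turns these two facts
into a relative discrepancy `O(t^p)` between indicators. Adding `ε > 0` only lowers relative
discrepancies, so the JS weights are within `O(t^p)` of the ideal ones, uniformly in `ε`
(`abs_jsWeight_sub_le`).

The mapping has contact of order `q` at each ideal weight: `k + 1` for even `k`, and one more for
odd `k`, where `sgm` contributes a factor (`exists_mopMap_sub_le`). The threshold on `k` says `p q ≥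
r` (`le_maimOrder_mul`), so the final weights are within `O(t^r)` of the ideal ones. Both families
sum to one and the substencil values agree up to `O(t^r)`; hence the nonlinear reconstruction
differs from the linear full-stencil one by only `O(t^(2r))` (`exists_mopRecon_sub_fullRecon_le`).

The linear error is `Λ w^(2r-1)(y) τ^(2r-1) + O(t^(2r))`, so the total error is `O(t^(2r-1))` and
changes by `O(t^(2r))` between neighbouring cells (`exists_mopRecon_error_le`). This gain pays for
the division by `h`: the derivative of the exact cell average is the exact flux difference
(`exists_deriv_cellAvg_eq`), and the errors in the numerical flux cancel across a cell to order
`h^(2r)` because `f` is `C²` (`exists_increment_sub_le`). -/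

/-! ### Algebra of the reconstruction -/

/-- The cell averages of a function given in the unit-cell coordinate. -/
noncomputable def unitAvg (φ : ℝ → ℝ) (i : ℤ) : ℝ :=
  ∫ ξ in ((i : ℝ) - 1 / 2)..((i : ℝ) + 1 / 2), φ ξ

/-- The partial sums of the data are combinations of step sequences, and interpolation and
differentiation are linear. This representation yields both stability in the data and linearity of
the full-stencil scheme. -/
theorem exists_reconPoly_kernel (a : ℤ) (n : ℕ) :
    ∃ K : ℕ → ℝ[X], ∀ v, reconPoly a n v = ∑ i ∈ range n, C (v (a + i)) * K i := by
  refine ⟨fun i => derivative (Lagrange.interpolate (range (n + 1))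
    (fun q : ℕ => (a : ℝ) - 1 / 2 + q) (fun q : ℕ => if i < q then 1 else 0)), fun v => ?_⟩
  have h : Lagrange.interpolate (range (n + 1)) (fun q : ℕ => (a : ℝ) - 1 / 2 + q)
        (fun q : ℕ => ∑ i ∈ range q, v (a + i))
      = Lagrange.interpolate (range (n + 1)) (fun q : ℕ => (a : ℝ) - 1 / 2 + q)
        (∑ i ∈ range n, v (a + i) • (fun q : ℕ => if i < q then (1 : ℝ) else 0)) := by
    apply Lagrange.interpolate_eq_of_values_eq_on
    intro q hq
    have hq : q ≤ n := by simpa [Nat.lt_succ_iff] using hq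
    simp only [Finset.sum_apply, Pi.smul_apply, smul_eq_mul, mul_ite, mul_one, mul_zero]
    rw [← Finset.sum_filter]
    refine Finset.sum_congr ?_ fun _ _ => rfl
    ext i
    simp only [Finset.mem_filter, Finset.mem_range]
    omega
  rw [reconPoly, h, map_sum, derivative_sum]
  refine Finset.sum_congr rfl fun i _ => ?_
  rw [map_smul, Polynomial.smul_eq_C_mul, derivative_C_mul]

theorem exists_derivative_eq (p : ℝ[X]) :
    ∃ Q : ℝ[X], derivative Q = p ∧ Q.natDegree ≤ p.natDegree + 1 := by
  refine ⟨∑ i ∈ range (p.natDegree + 1), C (p.coeff i / (i + 1)) * X ^ (i + 1), ?_, ?_⟩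
  · rw [derivative_sum]
    conv_rhs => rw [p.as_sum_range_C_mul_X_pow]
    refine Finset.sum_congr rfl fun i _ => ?_
    rw [derivative_C_mul_X_pow]
    have : (i : ℝ) + 1 ≠ 0 := by positivity
    simp only [Nat.cast_add, Nat.cast_one, Nat.add_sub_cancel]
    rw [div_mul_cancel₀ _ this]
  · refine natDegree_sum_le_of_forall_le _ _ fun i hi => ?_
    refine (natDegree_C_mul_X_pow_le _ _).trans ?_
    have := Finset.mem_range.1 hi
    omega

theorem unitAvg_derivative (Q : ℝ[X]) (i : ℤ) :
    unitAvg (fun ξ => (derivative Q).eval ξ) i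
      = Q.eval ((i : ℝ) + 1 / 2) - Q.eval ((i : ℝ) - 1 / 2) := by
  rw [unitAvg]
  exact intervalIntegral.integral_eq_sub_of_hasDerivAt (fun x _ => Q.hasDerivAt x)
    ((derivative Q).continuous.intervalIntegrable _ _)

/-- Polynomials of degree `< n` are reproduced by the reconstruction on `n` cells. -/
theorem reconPoly_unitAvg (a : ℤ) (n : ℕ) (p : ℝ[X]) (hp : p.natDegree < n) :
    reconPoly a n (unitAvg fun ξ => p.eval ξ) = p := by
  obtain ⟨Q, rfl, hQ⟩ := exists_derivative_eq p
  -- The primitive normalised to vanish at the left end of the stencil has exactly the partial sums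
  -- as interface values; its degree is at most `n`, so the `n + 1` nodes determine it.
  set Q' : ℝ[X] := Q - C (Q.eval ((a : ℝ) - 1 / 2)) with hQ'
  have hs : ∀ q : ℕ, ∑ i ∈ range q, unitAvg (fun ξ => (derivative Q).eval ξ) (a + i)
      = Q'.eval ((a : ℝ) - 1 / 2 + q) := by
    intro q
    induction q with
    | zero => simp [hQ']
    | succ q ih =>
      rw [Finset.sum_range_succ, ih, unitAvg_derivative]
      simp only [hQ', eval_sub, eval_C]
      push_cast
      rw [show (a : ℝ) + q + 1 / 2 = a - 1 / 2 + (q + 1) by ring,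
        show (a : ℝ) + q - 1 / 2 = a - 1 / 2 + q by ring]
      ring
  have hdeg : Q'.degree < ((range (n + 1)).card : ℕ) := by
    rw [Finset.card_range]
    refine lt_of_le_of_lt degree_le_natDegree ?_
    have h1 : Q'.natDegree ≤ max Q.natDegree 0 := by
      refine (natDegree_sub_le _ _).trans ?_
      simp
    have : Q'.natDegree < n + 1 := by
      have : max Q.natDegree 0 = Q.natDegree := by simp
      omega
    exact_mod_cast this
  have hinj : Set.InjOn (fun q : ℕ => (a : ℝ) - 1 / 2 + q) (range (n + 1)) := by
    intro i _ j _ h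
    simpa using h
  have := Lagrange.eq_interpolate hinj hdeg
  rw [reconPoly]
  have e : Lagrange.interpolate (range (n + 1)) (fun q : ℕ => (a : ℝ) - 1 / 2 + q)
      (fun q : ℕ => ∑ i ∈ range q, unitAvg (fun ξ => (derivative Q).eval ξ) (a + i)) = Q' := by
    conv_rhs => rw [this]
    congr 1
    funext q
    exact hs q
  rw [e, hQ', derivative_sub, derivative_C, sub_zero]

theorem exists_abs_eval_le (p : ℝ[X]) :
    ∃ B : ℝ, 0 ≤ B ∧ ∀ ξ ∈ Set.Icc (-(1 / 2) : ℝ) (1 / 2), |p.eval ξ| ≤ B := by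
  obtain ⟨B, hB⟩ := isCompact_Icc.exists_bound_of_continuousOn
    (p.continuous.continuousOn (s := Set.Icc (-(1 / 2) : ℝ) (1 / 2)))
  exact ⟨|B|, abs_nonneg _, fun ξ hξ => (hB ξ hξ).trans (le_abs_self _)⟩

/-- Stability of the reconstruction and of its derivatives with respect to the data. -/
theorem exists_reconPoly_sub_le (a : ℤ) (n l : ℕ) :
    ∃ B : ℝ, 0 ≤ B ∧ ∀ v v' : ℤ → ℝ, ∀ D : ℝ, (∀ i < n, |v (a + i) - v' (a + i)| ≤ D) →
      ∀ ξ ∈ Set.Icc (-(1 / 2) : ℝ) (1 / 2),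
        |(derivative^[l] (reconPoly a n v)).eval ξ - (derivative^[l] (reconPoly a n v')).eval ξ|
          ≤ B * D := by
  obtain ⟨K, hK⟩ := exists_reconPoly_kernel a n
  choose B hB0 hB using fun i => exists_abs_eval_le (derivative^[l] (K i))
  refine ⟨∑ i ∈ range n, B i, Finset.sum_nonneg fun i _ => hB0 i, fun v v' D hD ξ hξ => ?_⟩
  have e : ∀ v, (derivative^[l] (reconPoly a n v)).eval ξ
      = ∑ i ∈ range n, v (a + i) * (derivative^[l] (K i)).eval ξ := by
    intro v
    rw [hK, iterate_derivative_sum, eval_finsetSum]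
    simp [iterate_derivative_C_mul]
  rw [e, e, ← Finset.sum_sub_distrib, Finset.sum_mul]
  refine (Finset.abs_sum_le_sum_abs _ _).trans (Finset.sum_le_sum fun i hi => ?_)
  rw [← sub_mul, abs_mul, mul_comm]
  exact mul_le_mul (hB i ξ hξ) (hD i (Finset.mem_range.1 hi)) (abs_nonneg _) (hB0 i)

theorem unitAvg_sub_le {φ ψ : ℝ → ℝ} {i : ℤ} {D : ℝ}
    (hφ : ContinuousOn φ (Set.Icc ((i : ℝ) - 1 / 2) (i + 1 / 2)))
    (hψ : ContinuousOn ψ (Set.Icc ((i : ℝ) - 1 / 2) (i + 1 / 2)))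
    (h : ∀ ξ ∈ Set.Icc ((i : ℝ) - 1 / 2) (i + 1 / 2), |φ ξ - ψ ξ| ≤ D) :
    |unitAvg φ i - unitAvg ψ i| ≤ D := by
  have hle : ((i : ℝ) - 1 / 2) ≤ i + 1 / 2 := by linarith
  rw [unitAvg, unitAvg, ← intervalIntegral.integral_sub
    (hφ.intervalIntegrable_of_Icc hle) (hψ.intervalIntegrable_of_Icc hle)]
  have := intervalIntegral.norm_integral_le_of_norm_le_const (a := (i : ℝ) - 1 / 2)
    (b := i + 1 / 2) (f := fun ξ => φ ξ - ψ ξ) (C := D) (fun ξ hξ => by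
      rw [Set.uIoc_of_le hle] at hξ
      exact h ξ ⟨hξ.1.le, hξ.2⟩)
  rw [show (i : ℝ) + 1 / 2 - (i - 1 / 2) = 1 by ring, abs_one, mul_one] at this
  exact this

/-- Reconstruction from the averages of a function close to a polynomial. -/
theorem exists_reconPoly_approx (a : ℤ) (n L : ℕ) (R : ℝ) (ha : -R ≤ (a : ℝ) - 1 / 2)
    (hb : (a : ℝ) + n - 1 / 2 ≤ R) :
    ∃ B : ℝ, 0 ≤ B ∧ ∀ l ≤ L, ∀ φ : ℝ → ℝ, ∀ T : ℝ[X], ∀ D : ℝ,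
      ContinuousOn φ (Set.Icc (-R) R) →
      (∀ ξ ∈ Set.Icc (-R) R, |φ ξ - T.eval ξ| ≤ D) → 0 ≤ D →
      ∀ ξ ∈ Set.Icc (-(1 / 2) : ℝ) (1 / 2),
        |(derivative^[l] (reconPoly a n (unitAvg φ))).eval ξ
          - (derivative^[l] (reconPoly a n (unitAvg fun ξ => T.eval ξ))).eval ξ| ≤ B * D := by
  choose B hB0 hB using exists_reconPoly_sub_le a n
  refine ⟨∑ l ∈ range (L + 1), B l, Finset.sum_nonneg fun i _ => hB0 i,
    fun l hl φ T D hφ hD hD0 ξ hξ => ?_⟩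
  refine (hB l _ _ D (fun i hi => ?_) ξ hξ).trans ?_
  · have hi' : (i : ℝ) + 1 ≤ n := by exact_mod_cast hi
    have hi0 : (0 : ℝ) ≤ i := Nat.cast_nonneg i
    have hsub : Set.Icc ((((a + i : ℤ)) : ℝ) - 1 / 2) (((a + i : ℤ) : ℝ) + 1 / 2)
        ⊆ Set.Icc (-R) R := by
      push_cast
      exact Set.Icc_subset_Icc (by linarith) (by linarith)
    exact unitAvg_sub_le (hφ.mono hsub) T.continuous.continuousOn
      fun ξ hξ => hD ξ (hsub hξ)
  · exact mul_le_mul_of_nonneg_right (Finset.single_le_sum (f := B) (fun i _ => hB0 i)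
      (Finset.mem_range.2 (by omega))) hD0

theorem idealWeight_pos {r s : ℕ} (hs : s < r) : 0 < idealWeight r s := by
  have h1 : 0 < r.choose s := Nat.choose_pos hs.le
  have h2 : 0 < (r - 1).choose s := Nat.choose_pos (by omega)
  have h3 : 0 < (2 * r - 1).choose r := Nat.choose_pos (by omega)
  rw [idealWeight]
  positivity

/-- Every substencil and the full stencil reproduce the constant `1`; testing the weight identity on
it gives the sum. -/
theorem sum_idealWeight (r : ℕ) (hr : 1 ≤ r) : ∑ s ∈ range r, idealWeight r s = 1 := by
  have h := sum_idealWeight_mul_subRecon r hr (unitAvg fun ξ => (1 : ℝ[X]).eval ξ)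
  have h1 : ∀ s, subRecon r s (unitAvg fun ξ => (1 : ℝ[X]).eval ξ) = 1 := fun s => by
    rw [subRecon, subPoly, reconPoly_unitAvg _ _ _ (by simp; omega), eval_one]
  rw [fullRecon, reconPoly_unitAvg _ _ _ (by simp; omega), eval_one] at h
  simpa only [h1, mul_one] using h

theorem idealWeight_lt_one {r s : ℕ} (hr : 2 ≤ r) (hs : s < r) : idealWeight r s < 1 := by
  rw [← sum_idealWeight r (by omega)]
  obtain ⟨t, ht, hts⟩ : ∃ t, t < r ∧ t ≠ s := by
    rcases Nat.eq_zero_or_pos s with rfl | h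
    · exact ⟨1, by omega, by omega⟩
    · exact ⟨0, by omega, by omega⟩
  exact Finset.single_lt_sum hts (Finset.mem_range.2 hs) (Finset.mem_range.2 ht)
    (idealWeight_pos ht) fun k hk _ => (idealWeight_pos (Finset.mem_range.1 hk)).le

/-! ### Perturbation of the weights -/

theorem abs_sum_sub_one_le {r : ℕ} {d a : ℕ → ℝ} {η : ℝ} (hd : ∑ s ∈ range r, d s = 1)
    (ha : ∀ s < r, |a s - d s| ≤ η) : |∑ s ∈ range r, a s - 1| ≤ r * η := by
  rw [← hd, ← Finset.sum_sub_distrib]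
  refine (Finset.abs_sum_le_sum_abs _ _).trans ?_
  refine (Finset.sum_le_sum fun s hs => ha s (Finset.mem_range.1 hs)).trans ?_
  simp

/-- With `S` the sum of the `a l`, the error is `((a - d) - d (S - 1)) / S`, and `S ≥ 1/2` by the
smallness of `r η`. Used for the JS weights and again for the mapped weights. -/
theorem abs_div_sum_sub_le {r : ℕ} {d a : ℕ → ℝ} {η : ℝ} (hd : ∑ s ∈ range r, d s = 1)
    (ha : ∀ s < r, |a s - d s| ≤ η) (hη : r * η ≤ 1 / 2) {s : ℕ} (hs : s < r)
    (h0 : 0 ≤ d s) (h1 : d s ≤ 1) :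
    |a s / ∑ l ∈ range r, a l - d s| ≤ 2 * (r + 1) * η := by
  have hS := abs_sum_sub_one_le hd ha
  set S := ∑ l ∈ range r, a l
  have hSpos : 1 / 2 ≤ S := by
    have := (abs_le.1 hS).1
    linarith
  have hS0 : 0 < S := by linarith
  have e : a s / S - d s = ((a s - d s) - d s * (S - 1)) / S := by
    field_simp
    ring
  have hη0 : 0 ≤ η := (abs_nonneg _).trans (ha s hs)
  rw [e, abs_div, abs_of_pos hS0, div_le_iff₀ hS0]
  have h2 : |d s * (S - 1)| ≤ r * η := by
    rw [abs_mul, abs_of_nonneg h0]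
    calc d s * |S - 1| ≤ 1 * |S - 1| := mul_le_mul_of_nonneg_right h1 (abs_nonneg _)
      _ ≤ r * η := by rw [one_mul]; exact hS
  calc |a s - d s - d s * (S - 1)| ≤ |a s - d s| + |d s * (S - 1)| := abs_sub _ _
    _ ≤ η + r * η := add_le_add (ha s hs) h2
    _ = 2 * (r + 1) * η * (1 / 2) := by ring
    _ ≤ 2 * (r + 1) * η * S := by gcongr

theorem smoothness_nonneg (r s : ℕ) (v : ℤ → ℝ) : 0 ≤ smoothness r s v :=
  Finset.sum_nonneg fun _ _ => intervalIntegral.integral_nonneg (by norm_num)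
    fun _ _ => sq_nonneg _

/-- Normalisation ignores a common factor, so each `jsAlpha` may be multiplied by `(ε + β_0)²`; it
then becomes `d_s / (1 + e)²` with `|e| ≤ η`. The bound is free of `ε` because `β_0 ≤ ε + β_0`. -/
theorem abs_jsWeight_sub_le {r : ℕ} (hr : 2 ≤ r) {ε : ℝ} (hε : 0 < ε) {v : ℤ → ℝ} {η : ℝ}
    (hβ : ∀ s < r, |smoothness r s v - smoothness r 0 v| ≤ η * smoothness r 0 v)
    (hη0 : 0 ≤ η) (hη : r * (10 * η) ≤ 1 / 2) {s : ℕ} (hs : s < r) :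
    |jsWeight r ε v s - idealWeight r s| ≤ 20 * (r + 1) * η := by
  set b := ε + smoothness r 0 v with hb
  have hb0 : 0 < b := add_pos_of_pos_of_nonneg hε (smoothness_nonneg _ _ _)
  have hη1 : η ≤ 1 / 40 := by
    have : (2 : ℝ) ≤ r := by exact_mod_cast hr
    nlinarith
  have ha : ∀ s < r, |jsAlpha r ε v s * b ^ 2 - idealWeight r s| ≤ 10 * η := by
    intro s hs
    obtain ⟨e, he⟩ : ∃ e, ε + smoothness r s v = b * (1 + e) :=
      ⟨(ε + smoothness r s v) / b - 1, by field_simp; ring⟩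
    have he1 : |e| ≤ η := by
      have h1 : b * e = smoothness r s v - smoothness r 0 v := by rw [hb] at he ⊢; linarith
      have h2 : b * |e| ≤ η * b := by
        rw [← abs_of_pos hb0, ← abs_mul, abs_of_pos hb0, h1]
        refine (hβ s hs).trans (mul_le_mul_of_nonneg_left ?_ hη0)
        rw [hb]; linarith
      rw [mul_comm] at h2
      exact le_of_mul_le_mul_right h2 hb0
    obtain ⟨he2, he3⟩ := abs_le.1 he1
    have he4 : 0 < 1 + e := by linarith
    have hd0 := idealWeight_pos hs
    have hd1 := idealWeight_lt_one hr hs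
    have e1 : jsAlpha r ε v s * b ^ 2 - idealWeight r s
        = idealWeight r s * (-(e * (2 + e))) / (1 + e) ^ 2 := by
      rw [jsAlpha, he]
      field_simp
      ring
    rw [e1, abs_div, abs_of_pos (by positivity : (0 : ℝ) < (1 + e) ^ 2),
      div_le_iff₀ (by positivity), abs_mul, abs_of_pos hd0, abs_neg, abs_mul,
      abs_of_pos (by linarith : 0 < 2 + e)]
    have h3 : |e| * (2 + e) ≤ η * 3 :=
      mul_le_mul he1 (by linarith) (by linarith) hη0
    have h4 : idealWeight r s * (|e| * (2 + e)) ≤ 1 * (η * 3) :=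
      mul_le_mul hd1.le h3 (mul_nonneg (abs_nonneg _) (by linarith)) zero_le_one
    have h5 : (1 / 2 : ℝ) ≤ (1 + e) ^ 2 := by nlinarith
    nlinarith
  have h := abs_div_sum_sub_le (sum_idealWeight r (by omega)) ha hη hs (idealWeight_pos hs).le
    (idealWeight_lt_one hr hs).le
  rw [← Finset.sum_mul, mul_div_mul_right _ _ (by positivity : b ^ 2 ≠ 0)] at h
  rw [jsWeight]
  linarith

/-! ### The mapping functions near the ideal weights -/

/-- For odd `k` the sign of `sgm` compensates that of the odd power. Hence the denominator of the
mapping is never below its `rpow` part near `d`. -/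
theorem maimFactor_mul_pow_nonneg (P : MAIMParams) (hA : 0 < P.A) {d ω : ℝ}
    (hω : |ω - d| < P.δ) : 0 ≤ maimFactor P d ω * (ω - d) ^ P.k := by
  set x := ω - d
  rcases Nat.even_or_odd P.k with hk | hk
  · have : maimFactor P d ω = P.A := by
      rw [maimFactor, hk.neg_one_pow, (hk.add_one).neg_one_pow]; ring
    rw [this]
    exact mul_nonneg hA.le (hk.pow_nonneg x)
  · have : maimFactor P d ω = P.A * sgm x P.δ 1 P.k := by
      rw [maimFactor, hk.neg_one_pow, (hk.add_one).neg_one_pow]; ring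
    rw [this, sgm, if_neg (not_le.2 hω), one_mul]
    have h2 : 0 ≤ P.δ ^ 2 - x ^ 2 := by
      have := pow_le_pow_left₀ (abs_nonneg x) hω.le 2
      rw [sq_abs] at this
      linarith
    have h3 : 0 ≤ x * x ^ P.k := by
      rw [← pow_succ']
      exact hk.add_one.pow_nonneg x
    rw [mul_assoc, div_mul_eq_mul_div]
    positivity

/-- The order of contact of the mapping function with its fixed point. -/
def maimOrder (k : ℕ) : ℕ := if Even k then k + 1 else k + 2

/-- For even `k` the factor is the constant `A`. For odd `k` it is `A · sgm`, which is `O(|ω - d|)`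
since for `|ω - d| ≤ δ/2` its denominator stays above `(δ²/2)^(k+3)`; this is the extra order of
contact. -/
theorem exists_maimFactor_le (P : MAIMParams) (hA : 0 < P.A) (hδ : 0 < P.δ) (d : ℝ) :
    ∃ B : ℝ, 0 ≤ B ∧ ∀ ω, |ω - d| ≤ P.δ / 2 →
      |maimFactor P d ω * (ω - d) ^ (P.k + 1)| ≤ B * |ω - d| ^ maimOrder P.k := by
  rcases Nat.even_or_odd P.k with hk | hk
  · refine ⟨P.A, hA.le, fun ω _ => ?_⟩
    have : maimFactor P d ω = P.A := by
      rw [maimFactor, hk.neg_one_pow, (hk.add_one).neg_one_pow]; ring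
    rw [this, abs_mul, abs_of_pos hA, abs_pow, maimOrder, if_pos hk]
  · refine ⟨P.A / (P.δ ^ 2 / 2) ^ (P.k + 3), by positivity, fun ω hω => ?_⟩
    have hlt : |ω - d| < P.δ := by linarith
    have : maimFactor P d ω = P.A * sgm (ω - d) P.δ 1 P.k := by
      rw [maimFactor, hk.neg_one_pow, (hk.add_one).neg_one_pow]; ring
    rw [this, sgm, if_neg (not_le.2 hlt), one_mul, maimOrder, if_neg (Nat.not_even_iff_odd.2 hk)]
    set x := ω - d
    have h2 : P.δ ^ 2 / 2 ≤ P.δ ^ 2 - x ^ 2 := by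
      have := pow_le_pow_left₀ (abs_nonneg x) hω 2
      rw [sq_abs] at this
      nlinarith [sq_nonneg P.δ]
    have h3 : (P.δ ^ 2 / 2) ^ (P.k + 3) ≤ (P.δ ^ 2 - x ^ 2) ^ (P.k + 3) + |x| := by
      have := pow_le_pow_left₀ (by positivity) h2 (P.k + 3)
      linarith [abs_nonneg x]
    have h4 : 0 < (P.δ ^ 2 / 2) ^ (P.k + 3) := by positivity
    rw [abs_mul, abs_mul, abs_of_pos hA, abs_div, abs_of_pos (h4.trans_le h3), abs_pow]
    calc P.A * (|x| / ((P.δ ^ 2 - x ^ 2) ^ (P.k + 3) + |x|)) * |x| ^ (P.k + 1)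
        ≤ P.A * (|x| / (P.δ ^ 2 / 2) ^ (P.k + 3)) * |x| ^ (P.k + 1) := by gcongr
      _ = _ := by ring

/-- The `rpow` part `W` of the denominator is continuous and positive at `d ∈ (0, 1)`, so the
denominator is at least `W d / 2` nearby and the numerator alone decides the order. -/
theorem exists_maimMap_sub_le (P : MAIMParams) (hA : 0 < P.A) (hδ : 0 < P.δ) (hεA : 0 < P.εA)
    {d m : ℝ} (hd0 : 0 < d) (hd1 : d < 1) (hm : 0 < m) :
    ∃ B η₀ : ℝ, 0 ≤ B ∧ 0 < η₀ ∧ ∀ ω, |ω - d| ≤ η₀ →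
      |maimMap P d m ω - d| ≤ B * |ω - d| ^ maimOrder P.k := by
  set W : ℝ → ℝ := fun ω =>
    ω ^ (d / (m * ω + P.εA)) * (1 - ω) ^ ((1 - d) / (m * (1 - ω) + P.εA)) with hW
  have hd1' : 0 < 1 - d := by linarith
  have hWc : ContinuousAt W d := by
    have h1 : m * d + P.εA ≠ 0 := by positivity
    have h2 : m * (1 - d) + P.εA ≠ 0 := by positivity
    refine ContinuousAt.mul (ContinuousAt.rpow (by fun_prop) ?_ (Or.inl hd0.ne'))
      (ContinuousAt.rpow (by fun_prop) ?_ (Or.inl hd1'.ne'))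
    · exact ContinuousAt.div (by fun_prop) (by fun_prop) h1
    · exact ContinuousAt.div (by fun_prop) (by fun_prop) h2
  have hWd : 0 < W d := mul_pos (Real.rpow_pos_of_pos hd0 _) (Real.rpow_pos_of_pos hd1' _)
  have hev : ∀ᶠ ω in 𝓝 d, W d / 2 < W ω := hWc.eventually (lt_mem_nhds (by linarith))
  obtain ⟨η, hη, hηW⟩ := Metric.eventually_nhds_iff.1 hev
  obtain ⟨B, hB0, hB⟩ := exists_maimFactor_le P hA hδ d
  refine ⟨B / (W d / 2), min (η / 2) (P.δ / 2), by positivity, by positivity, fun ω hω => ?_⟩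
  have h1 : |ω - d| ≤ η / 2 := hω.trans (min_le_left _ _)
  have h2 : |ω - d| ≤ P.δ / 2 := hω.trans (min_le_right _ _)
  have h3 := maimFactor_mul_pow_nonneg P hA (d := d) (ω := ω) (by linarith)
  have h4 : W d / 2 < W ω := hηW (by rw [Real.dist_eq]; linarith)
  have h5 : W d / 2 ≤ maimFactor P d ω * (ω - d) ^ P.k + W ω := by linarith
  have e : maimMap P d m ω - d = maimFactor P d ω * (ω - d) ^ (P.k + 1) /
      (maimFactor P d ω * (ω - d) ^ P.k + W ω) := by
    rw [maimMap, hW]; ring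
  have h6 : 0 < W d / 2 := by positivity
  rw [e, abs_div, abs_of_pos (h6.trans_le h5), div_mul_eq_mul_div]
  exact div_le_div₀ (by positivity) (hB ω h2) h6 h5

theorem exists_pos_forall_le (g : ℕ → ℝ) (hg : ∀ i, 0 < g i) (r : ℕ) :
    ∃ c : ℝ, 0 < c ∧ ∀ i < r, c ≤ g i := by
  induction r with
  | zero => exact ⟨1, one_pos, by simp⟩
  | succ r ih =>
    obtain ⟨c, hc, h⟩ := ih
    refine ⟨min c (g r), lt_min hc (hg r), fun i hi => ?_⟩
    rcases Nat.lt_succ_iff_lt_or_eq.1 hi with h' | rfl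
    · exact (min_le_left _ _).trans (h i h')
    · exact min_le_right _ _

theorem minDistIndex_spec {r : ℕ} (hr : 0 < r) (d : ℕ → ℝ) (ω : ℝ) :
    minDistIndex r d ω < r ∧ ∀ i < r, |ω - d (minDistIndex r d ω)| ≤ |ω - d i| := by
  have hne : {k | k < r ∧ ∀ i < r, |ω - d k| ≤ |ω - d i|}.Nonempty := by
    obtain ⟨k, hk, h⟩ := Finset.exists_min_image (range r) (fun i => |ω - d i|)
      ⟨0, Finset.mem_range.2 hr⟩
    exact ⟨k, Finset.mem_range.1 hk, fun i hi => h i (Finset.mem_range.2 hi)⟩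
  exact Nat.sInf_mem hne

/-- Close to `d_s` the selected index `t` must satisfy `d_t = d_s`. The index, and with it `m_t`,
may still differ from `s`, but the order of contact does not depend on `m`. -/
theorem exists_mopMap_sub_le {r : ℕ} (hr : 2 ≤ r) (P : MAIMParams) (hA : 0 < P.A) (hδ : 0 < P.δ)
    (hεA : 0 < P.εA) (hm : ∀ s < r, 0 < P.m s) :
    ∃ B η₀ : ℝ, 0 ≤ B ∧ 0 < η₀ ∧ ∀ s < r, ∀ ω, |ω - idealWeight r s| ≤ η₀ →
      |mopMap r P ω - idealWeight r s| ≤ B * |ω - idealWeight r s| ^ maimOrder P.k := by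
  have key : ∀ s t : ℕ, ∃ B η₀ : ℝ, 0 ≤ B ∧ 0 < η₀ ∧ (s < r → t < r → ∀ ω,
      |ω - idealWeight r s| ≤ η₀ → |ω - idealWeight r t| ≤ |ω - idealWeight r s| →
      |maimMap P (idealWeight r t) (P.m t) ω - idealWeight r s|
        ≤ B * |ω - idealWeight r s| ^ maimOrder P.k) := by
    intro s t
    by_cases hst : s < r ∧ t < r
    · obtain ⟨hs, ht⟩ := hst
      rcases eq_or_ne (idealWeight r t) (idealWeight r s) with h | h
      · obtain ⟨B, η, hB, hη, H⟩ := exists_maimMap_sub_le P hA hδ hεA (idealWeight_pos hs)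
          (idealWeight_lt_one hr hs) (hm t ht)
        rw [h]
        exact ⟨B, η, hB, hη, fun _ _ ω hω _ => H ω hω⟩
      -- If `d_t ≠ d_s`, being within a third of the gap from `d_s` while no farther from `d_t`
      -- contradicts the triangle inequality, so any constant will do.
      · refine ⟨0, |idealWeight r t - idealWeight r s| / 3, le_rfl,
          by have := abs_pos.2 (sub_ne_zero.2 h); positivity, fun _ _ ω h1 h2 => ?_⟩
        exfalso
        have h3 : |idealWeight r t - idealWeight r s|
            ≤ |ω - idealWeight r s| + |ω - idealWeight r t| := by
          rw [abs_sub_comm ω (idealWeight r t), add_comm]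
          exact abs_sub_le _ _ _
        have := abs_pos.2 (sub_ne_zero.2 h)
        linarith
    · exact ⟨0, 1, le_rfl, one_pos, fun h1 h2 => absurd ⟨h1, h2⟩ hst⟩
  choose B η hB hη H using key
  choose c hc hcη using fun s => exists_pos_forall_le (η s) (hη s) r
  obtain ⟨c', hc', hc'c⟩ := exists_pos_forall_le c hc r
  refine ⟨∑ s ∈ range r, ∑ t ∈ range r, B s t, c',
    Finset.sum_nonneg fun s _ => Finset.sum_nonneg fun t _ => hB s t, hc', fun s hs ω hω => ?_⟩
  obtain ⟨ht, hmin⟩ := minDistIndex_spec (by omega : 0 < r) (idealWeight r) ω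
  rw [mopMap, minDist, minDist]
  refine (H s _ hs ht ω (hω.trans ((hc'c s hs).trans (hcη s _ ht))) (hmin s hs)).trans ?_
  refine mul_le_mul_of_nonneg_right ?_ (by positivity)
  calc B s _ ≤ ∑ t ∈ range r, B s t :=
        Finset.single_le_sum (fun t _ => hB s t) (Finset.mem_range.2 ht)
    _ ≤ _ := Finset.single_le_sum (f := fun s => ∑ t ∈ range r, B s t)
        (fun s _ => Finset.sum_nonneg fun t _ => hB s t) (Finset.mem_range.2 hs)

theorem maimOrder_pos (k : ℕ) : 1 ≤ maimOrder k := by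
  rw [maimOrder]; split_ifs <;> omega

/-- If the smoothness indicators agree up to a relative error `η`, then the mapped weights agree
with the ideal ones up to a multiple of a power of `η`, and the reconstruction is close to the
one of the full stencil. -/
theorem exists_mopRecon_sub_le {r : ℕ} (hr : 2 ≤ r) (P : MAIMParams) (hA : 0 < P.A)
    (hδ : 0 < P.δ) (hεA : 0 < P.εA) (hm : ∀ s < r, 0 < P.m s) :
    ∃ B η₀ : ℝ, 0 ≤ B ∧ 0 < η₀ ∧ ∀ (v : ℤ → ℝ) (ε η c D : ℝ), 0 < ε → 0 ≤ η → η ≤ η₀ →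
      (∀ s < r, |smoothness r s v - smoothness r 0 v| ≤ η * smoothness r 0 v) →
      (∀ s < r, |subRecon r s v - c| ≤ D) →
      |mopRecon r P ε v - fullRecon r v| ≤ B * η ^ maimOrder P.k * D := by
  obtain ⟨B, η₁, hB, hη₁, H⟩ := exists_mopMap_sub_le hr P hA hδ hεA hm
  set q := maimOrder P.k
  have hq : 1 ≤ q := maimOrder_pos _
  have hr0 : (0 : ℝ) < r := by exact_mod_cast (by omega : 0 < r)
  set κ : ℝ := 20 * (r + 1)
  have hκ : 0 < κ := by positivity
  set E : ℝ := B * κ ^ q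
  have hE : 0 ≤ E := by positivity
  -- The bounds on `η` serve, in order: the JS weight estimate, entry into the domain of the mapping
  -- estimate, `η ^ q ≤ η`, and a sum of mapped weights at least `1/2`.
  refine ⟨r * (2 * (r + 1) * E), min (min (1 / (20 * r)) (η₁ / κ)) (min 1 (1 / (2 * r * (E + 1)))),
    by positivity, by positivity, fun v ε η c D hε hη hηle hβ hD => ?_⟩
  have h1 : η ≤ 1 / (20 * r) := hηle.trans ((min_le_left _ _).trans (min_le_left _ _))
  have h2 : η ≤ η₁ / κ := hηle.trans ((min_le_left _ _).trans (min_le_right _ _))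
  have h3 : η ≤ 1 := hηle.trans ((min_le_right _ _).trans (min_le_left _ _))
  have h4 : η ≤ 1 / (2 * r * (E + 1)) := hηle.trans ((min_le_right _ _).trans (min_le_right _ _))
  rw [le_div_iff₀ (by positivity)] at h1 h2 h4
  have hG : ∀ s < r, |mopMap r P (jsWeight r ε v s) - idealWeight r s| ≤ E * η ^ q := by
    intro s hs
    have h5 := abs_jsWeight_sub_le hr hε hβ hη (by linarith) hs
    refine (H s hs _ (h5.trans (by linarith))).trans ?_
    calc B * |jsWeight r ε v s - idealWeight r s| ^ q ≤ B * (κ * η) ^ q := by gcongr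
      _ = E * η ^ q := by rw [mul_pow]; ring
  have hsmall : r * (E * η ^ q) ≤ 1 / 2 := by
    have h6 : η ^ q ≤ η := by
      calc η ^ q ≤ η ^ 1 := pow_le_pow_of_le_one hη h3 hq
        _ = η := pow_one _
    have h7 : r * (E * η ^ q) ≤ r * ((E + 1) * η) := by gcongr; linarith
    nlinarith
  have hsum := abs_sum_sub_one_le (a := fun s => mopMap r P (jsWeight r ε v s))
    (sum_idealWeight r (by omega)) hG
  have hne : ∑ s ∈ range r, mopMap r P (jsWeight r ε v s) ≠ 0 := by
    intro h
    rw [h] at hsum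
    norm_num at hsum
    linarith
  have hw1 : ∑ s ∈ range r, mopWeight r P ε v s = 1 := by
    simp only [mopWeight]
    rw [← Finset.sum_div, div_self hne]
  have hw : ∀ s < r, |mopWeight r P ε v s - idealWeight r s| ≤ 2 * (r + 1) * (E * η ^ q) :=
    fun s hs => abs_div_sum_sub_le (a := fun s => mopMap r P (jsWeight r ε v s))
      (sum_idealWeight r (by omega)) hG hsmall hs (idealWeight_pos hs).le
      (idealWeight_lt_one hr hs).le
  -- Both weight families sum to one, so any constant `c` may be subtracted from the substencil
  -- values; this gains the factor `D`.
  have e : mopRecon r P ε v - fullRecon r v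
      = ∑ s ∈ range r, (mopWeight r P ε v s - idealWeight r s) * (subRecon r s v - c) := by
    simp only [sub_mul, mul_sub, Finset.sum_sub_distrib, ← Finset.sum_mul]
    rw [hw1, sum_idealWeight r (by omega), sum_idealWeight_mul_subRecon r (by omega), mopRecon]
    ring
  rw [e]
  refine (Finset.abs_sum_le_sum_abs _ _).trans ?_
  calc ∑ s ∈ range r, |(mopWeight r P ε v s - idealWeight r s) * (subRecon r s v - c)|
      ≤ ∑ s ∈ range r, 2 * (r + 1) * (E * η ^ q) * D := by
        refine Finset.sum_le_sum fun s hs => ?_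
        have hs := Finset.mem_range.1 hs
        rw [abs_mul]
        exact mul_le_mul (hw s hs) (hD s hs) (abs_nonneg _) (by positivity)
    _ = _ := by rw [Finset.sum_const, Finset.card_range, nsmul_eq_mul]; ring

/-- The threshold on `k` yields the order of contact needed for the optimal order. -/
theorem le_maimOrder_mul {r n k : ℕ} (hn : n + 2 ≤ r) (hk : kMAIM r n ≤ (k : ℝ)) :
    r ≤ maimOrder k * (r - 1 - n) := by
  set p := r - 1 - n with hp
  have hp1 : 1 ≤ p := by omega
  have hpr : (r : ℝ) - 1 - n = p := by
    rw [hp, Nat.cast_sub (by omega), Nat.cast_sub (by omega)]; simp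
  have hp0 : (0 : ℝ) < p := by exact_mod_cast hp1
  have hc : (r : ℝ) ≤ ((maimCeil r n : ℝ) + 2) * p := by
    have : (r : ℝ) / p - 2 ≤ maimCeil r n := by
      rw [maimCeil, hpr]; exact Int.le_ceil _
    rw [← div_le_iff₀ hp0]
    linarith
  rw [kMAIM] at hk
  set c := maimCeil r n
  -- The parity correction in the threshold acts here. For even `c` it forces `k ≥ c + 1`. For odd
  -- `c`, the value `k = c` is odd and has contact `k + 2`, while an even `k` cannot equal `c`.
  have hq : c + 2 ≤ (maimOrder k : ℤ) := by
    rcases Int.even_or_odd c with h | h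
    · rw [h.neg_one_zpow] at hk
      have : c + 1 ≤ (k : ℤ) := by
        have : (c : ℝ) + 1 ≤ k := by linarith
        exact_mod_cast this
      rw [maimOrder]; split_ifs <;> push_cast <;> omega
    · rw [h.neg_one_zpow] at hk
      have : c ≤ (k : ℤ) := by
        have : (c : ℝ) ≤ k := by linarith
        exact_mod_cast this
      rw [maimOrder]
      split_ifs with hk2
      · have hne : c ≠ k := by
          rintro h'
          rw [h', Int.odd_iff] at h
          rw [Nat.even_iff] at hk2
          omega
        push_cast; omega
      · push_cast; omega
  have hq' : (c : ℝ) + 2 ≤ maimOrder k := by exact_mod_cast hq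
  have : (r : ℝ) ≤ maimOrder k * p := hc.trans (mul_le_mul_of_nonneg_right hq' hp0.le)
  exact_mod_cast this

/-! ### Taylor expansion near a point of smoothness -/

/-- On the interval of centre `x₀` and radius `ρ`, the function `w` has derivatives up to the
order `N`, and they are bounded by `M`. -/
def HasBoundedDerivs (w : ℝ → ℝ) (x₀ ρ M : ℝ) (N : ℕ) : Prop :=
  (∀ l < N, ∀ z ∈ Metric.ball x₀ ρ, HasDerivAt (iteratedDeriv l w) (iteratedDeriv (l + 1) w z) z) ∧
  ∀ l ≤ N, ∀ z ∈ Metric.ball x₀ ρ, |iteratedDeriv l w z| ≤ M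

theorem contDiffAt_iteratedDeriv {w : ℝ → ℝ} {z : ℝ} (l m : ℕ)
    (hw : ContDiffAt ℝ ((m + l : ℕ) : ℕ∞) w z) :
    ContDiffAt ℝ ((m : ℕ) : ℕ∞) (iteratedDeriv l w) z := by
  induction l generalizing m with
  | zero => simpa using hw
  | succ l ih =>
    rw [iteratedDeriv_succ]
    have h := ih (m + 1) (by rw [show m + 1 + l = m + (l + 1) by ring]; exact hw)
    have h2 := h.fderiv_right (m := ((m : ℕ) : ℕ∞)) (by norm_cast)
    exact h2.clm_apply contDiffAt_const

/-- Being `C^N` at a point with `N` finite spreads to a neighbourhood, and continuity there bounds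
the finitely many derivatives. -/
theorem exists_hasBoundedDerivs {w : ℝ → ℝ} {x₀ : ℝ} {N : ℕ}
    (hw : ContDiffAt ℝ ((N : ℕ) : ℕ∞) w x₀) :
    ∃ ρ M : ℝ, 0 < ρ ∧ 0 ≤ M ∧ HasBoundedDerivs w x₀ ρ M N := by
  have h1 : ∀ᶠ z in 𝓝 x₀, ContDiffAt ℝ ((N : ℕ) : ℕ∞) w z := hw.eventually (by simp)
  have h2 : ∀ᶠ z in 𝓝 x₀, ∀ l ∈ range (N + 1),
      |iteratedDeriv l w z| < |iteratedDeriv l w x₀| + 1 := by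
    rw [Filter.eventually_all_finset]
    intro l hl
    have hl := Finset.mem_range.1 hl
    have hc := contDiffAt_iteratedDeriv (w := w) (z := x₀) l (N - l)
      (by rwa [Nat.sub_add_cancel (by omega)])
    exact hc.continuousAt.abs.eventually (gt_mem_nhds (by linarith))
  obtain ⟨ρ, hρ, H⟩ := Metric.eventually_nhds_iff.1 (h1.and h2)
  refine ⟨ρ, ∑ l ∈ range (N + 1), (|iteratedDeriv l w x₀| + 1), hρ, by positivity,
    fun l hl z hz => ?_, fun l hl z hz => ?_⟩
  · have h3 := contDiffAt_iteratedDeriv (w := w) (z := z) l (N - l)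
      (by rw [Nat.sub_add_cancel (by omega)]; exact (H hz).1)
    have h4 : DifferentiableAt ℝ (iteratedDeriv l w) z :=
      h3.differentiableAt (by
        have : N - l ≠ 0 := by omega
        exact_mod_cast this)
    rw [iteratedDeriv_succ]
    exact h4.hasDerivAt
  · have hl : l ∈ range (N + 1) := Finset.mem_range.2 (by omega)
    exact ((H hz).2 l hl).le.trans (Finset.single_le_sum
      (f := fun l => |iteratedDeriv l w x₀| + 1) (fun i _ => by positivity) hl)

theorem HasBoundedDerivs.mono {w : ℝ → ℝ} {x₀ ρ ρ' M : ℝ} {N : ℕ}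
    (h : HasBoundedDerivs w x₀ ρ M N) (hρ : ρ' ≤ ρ) : HasBoundedDerivs w x₀ ρ' M N :=
  ⟨fun l hl z hz => h.1 l hl z (Metric.ball_subset_ball hρ hz),
    fun l hl z hz => h.2 l hl z (Metric.ball_subset_ball hρ hz)⟩

theorem HasBoundedDerivs.continuousOn {w : ℝ → ℝ} {x₀ ρ M : ℝ} {N : ℕ}
    (h : HasBoundedDerivs w x₀ ρ M N) (hN : 0 < N) : ContinuousOn w (Metric.ball x₀ ρ) :=
  fun z hz => by simpa using (h.1 0 hN z hz).continuousAt.continuousWithinAt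

theorem HasBoundedDerivs.lipschitz {w : ℝ → ℝ} {x₀ ρ M : ℝ} {N : ℕ}
    (h : HasBoundedDerivs w x₀ ρ M N) {l : ℕ} (hl : l < N) {y z : ℝ}
    (hy : y ∈ Metric.ball x₀ ρ) (hz : z ∈ Metric.ball x₀ ρ) :
    |iteratedDeriv l w z - iteratedDeriv l w y| ≤ M * |z - y| :=
  (convex_ball x₀ ρ).norm_image_sub_le_of_norm_hasDerivWithin_le
    (fun x hx => (h.1 l hl x hx).hasDerivWithinAt) (fun x hx => h.2 (l + 1) hl x hx) hy hz

/-- Taylor's theorem for all the derivatives, in a form that is proved by induction. -/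
theorem HasBoundedDerivs.taylor {w : ℝ → ℝ} {x₀ ρ M : ℝ} {N : ℕ}
    (h : HasBoundedDerivs w x₀ ρ M N) {y : ℝ} (hy : y ∈ Metric.ball x₀ ρ) (m : ℕ) :
    ∀ l, l + m ≤ N → ∀ z ∈ Metric.ball x₀ ρ,
      |iteratedDeriv l w z
        - ∑ i ∈ range m, iteratedDeriv (l + i) w y / (i.factorial : ℝ) * (z - y) ^ i|
        ≤ M * |z - y| ^ m := by
  induction m with
  | zero =>
    intro l hl z hz
    simpa using h.2 l hl z hz
  | succ m ih =>
    intro l hl z hz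
    set R : ℝ → ℝ := fun z => iteratedDeriv l w z
        - ∑ i ∈ range (m + 1), iteratedDeriv (l + i) w y / (i.factorial : ℝ) * (z - y) ^ i with hR
    have hRy : R y = 0 := by
      simp only [hR, sub_self]
      rw [Finset.sum_range_succ']
      simp
    have hd : ∀ x ∈ Metric.ball x₀ ρ, HasDerivAt R (iteratedDeriv (l + 1) w x
        - ∑ i ∈ range m, iteratedDeriv (l + 1 + i) w y / (i.factorial : ℝ) * (x - y) ^ i) x := by
      intro x hx
      refine (h.1 l (by omega) x hx).sub ?_
      have h1 : ∀ i ∈ range (m + 1), HasDerivAt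
          (fun z => iteratedDeriv (l + i) w y / (i.factorial : ℝ) * (z - y) ^ i)
          (iteratedDeriv (l + i) w y / (i.factorial : ℝ) * (i * (x - y) ^ (i - 1))) x := by
        intro i _
        have := (((hasDerivAt_id x).sub_const y).pow i).const_mul
          (iteratedDeriv (l + i) w y / (i.factorial : ℝ))
        simpa using this
      convert HasDerivAt.fun_sum h1 using 1
      rw [Finset.sum_range_succ']
      simp only [Nat.cast_zero, zero_mul, mul_zero, add_zero]
      refine Finset.sum_congr rfl fun i _ => ?_
      rw [show l + 1 + i = l + (i + 1) by ring, Nat.factorial_succ, Nat.add_sub_cancel]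
      push_cast
      have : (i : ℝ) + 1 ≠ 0 := by positivity
      have : (i.factorial : ℝ) ≠ 0 := by positivity
      field_simp
    -- `R` vanishes at `y` and its derivative is the remainder one order lower for the next
    -- derivative of `w`; the mean value inequality on the segment supplies the new factor `|z -
    -- y|`.
    set s := Set.uIcc y z
    have hs : s ⊆ Metric.ball x₀ ρ := (convex_ball x₀ ρ).ordConnected.uIcc_subset hy hz
    have hb : ∀ x ∈ s, ‖iteratedDeriv (l + 1) w x
        - ∑ i ∈ range m, iteratedDeriv (l + 1 + i) w y / (i.factorial : ℝ) * (x - y) ^ i‖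
        ≤ M * |z - y| ^ m := by
      intro x hx
      have hM : 0 ≤ M := (abs_nonneg _).trans (h.2 l (by omega) z hz)
      refine (ih (l + 1) (by omega) x (hs hx)).trans ?_
      have : |x - y| ≤ |z - y| := Set.abs_sub_left_of_mem_uIcc hx
      gcongr
    have := (convex_uIcc y z).norm_image_sub_le_of_norm_hasDerivWithin_le
      (fun x hx => (hd x (hs hx)).hasDerivWithinAt) hb Set.left_mem_uIcc Set.right_mem_uIcc
    rw [hRy, sub_zero, Real.norm_eq_abs, Real.norm_eq_abs] at this
    rw [pow_succ, ← mul_assoc]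
    exact this

/-- The Taylor polynomial of degree `< m` of `ξ ↦ w (y + τ ξ)` at `0`. -/
noncomputable def unitTaylor (w : ℝ → ℝ) (y τ : ℝ) (m : ℕ) : ℝ[X] :=
  ∑ i ∈ range m, C (iteratedDeriv i w y / (i.factorial : ℝ) * τ ^ i) * X ^ i

theorem natDegree_unitTaylor_lt (w : ℝ → ℝ) (y τ : ℝ) {m : ℕ} (hm : 0 < m) :
    (unitTaylor w y τ m).natDegree < m := by
  have : (unitTaylor w y τ m).natDegree ≤ m - 1 :=
    natDegree_sum_le_of_forall_le _ _ fun i hi => (natDegree_C_mul_X_pow_le _ _).trans (by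
      have := Finset.mem_range.1 hi; omega)
  omega

/-- Only the top coefficient survives. Taken at the order of the first nonvanishing derivative, this
gives the lower bound on the smoothness indicator. -/
theorem iterate_derivative_unitTaylor (w : ℝ → ℝ) (y τ : ℝ) (m : ℕ) :
    derivative^[m] (unitTaylor w y τ (m + 1)) = C (iteratedDeriv m w y * τ ^ m) := by
  have h : (unitTaylor w y τ m).natDegree < m ∨ m = 0 := by
    rcases Nat.eq_zero_or_pos m with h | h
    · exact Or.inr h
    · exact Or.inl (natDegree_unitTaylor_lt w y τ h)
  rw [unitTaylor, Finset.sum_range_succ, iterate_map_add, ← unitTaylor,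
    iterate_derivative_C_mul, iterate_derivative_X_pow_eq_C_mul, Nat.descFactorial_self,
    Nat.sub_self, pow_zero, mul_one, ← C_mul]
  have h0 : derivative^[m] (unitTaylor w y τ m) = 0 := by
    rcases h with h | rfl
    · exact iterate_derivative_eq_zero h
    · simp [unitTaylor]
  rw [h0, zero_add]
  congr 1
  have : (m.factorial : ℝ) ≠ 0 := by positivity
  field_simp

theorem mem_ball_add_mul {x₀ ρ y τ ξ R : ℝ} (hy : |y - x₀| < ρ / 2) (hτ : |τ| * R < ρ / 2)
    (hξ : ξ ∈ Set.Icc (-R) R) : y + τ * ξ ∈ Metric.ball x₀ ρ := by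
  rw [Metric.mem_ball, Real.dist_eq, show y + τ * ξ - x₀ = (y - x₀) + τ * ξ by ring]
  have : |τ * ξ| ≤ |τ| * R := by
    rw [abs_mul]
    exact mul_le_mul_of_nonneg_left (abs_le.2 hξ) (abs_nonneg _)
  linarith [abs_add_le (y - x₀) (τ * ξ)]

theorem HasBoundedDerivs.unitTaylor_sub_le {w : ℝ → ℝ} {x₀ ρ M : ℝ} {N : ℕ}
    (h : HasBoundedDerivs w x₀ ρ M N) {y τ R : ℝ} (hy : |y - x₀| < ρ / 2) (hR : 0 ≤ R)
    (hτ : |τ| * R < ρ / 2) {m : ℕ} (hm : m ≤ N) {ξ : ℝ} (hξ : ξ ∈ Set.Icc (-R) R) :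
    |w (y + τ * ξ) - (unitTaylor w y τ m).eval ξ| ≤ M * R ^ m * |τ| ^ m := by
  have hy0 : y ∈ Metric.ball x₀ ρ := by
    simpa using mem_ball_add_mul (ξ := 0) hy hτ ⟨by linarith, hR⟩
  have hz := mem_ball_add_mul hy hτ hξ
  have hM : 0 ≤ M := (abs_nonneg _).trans (h.2 0 (Nat.zero_le _) y hy0)
  have := h.taylor hy0 m 0 (by omega) _ hz
  have e : (unitTaylor w y τ m).eval ξ
      = ∑ i ∈ range m, iteratedDeriv (0 + i) w y / (i.factorial : ℝ) * (y + τ * ξ - y) ^ i := by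
    rw [unitTaylor, eval_finsetSum]
    refine Finset.sum_congr rfl fun i _ => ?_
    simp only [eval_mul, eval_C, eval_pow, eval_X, zero_add, add_sub_cancel_left]
    ring
  rw [e]
  rw [iteratedDeriv_zero] at this
  refine this.trans ?_
  have h2 : |y + τ * ξ - y| ≤ R * |τ| := by
    rw [add_sub_cancel_left, abs_mul, mul_comm]
    exact mul_le_mul_of_nonneg_right (abs_le.2 hξ) (abs_nonneg _)
  calc M * |y + τ * ξ - y| ^ m ≤ M * (R * |τ|) ^ m := by gcongr
    _ = _ := by rw [mul_pow]; ring

/-! ### Comparison of the smoothness indicators -/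

/-- Young's inequality applied to the cross term `2 b (a - b)`; the weight `η` is left free to be
balanced later. -/
theorem abs_sq_sub_sq_le {a b η K : ℝ} (hη : 0 < η) (h : |a - b| ≤ K) :
    |a ^ 2 - b ^ 2| ≤ η * b ^ 2 + (1 + 1 / η) * K ^ 2 := by
  have h1 : (a - b) ^ 2 ≤ K ^ 2 := by
    rw [← sq_abs]
    exact pow_le_pow_left₀ (abs_nonneg _) h 2
  have h2 : 2 * |b| * |a - b| ≤ η * b ^ 2 + 1 / η * (a - b) ^ 2 := by
    rw [← sq_abs b, ← sq_abs (a - b)]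
    have : η * |b| ^ 2 + 1 / η * |a - b| ^ 2 - 2 * |b| * |a - b|
        = 1 / η * (η * |b| - |a - b|) ^ 2 := by
      field_simp
      ring
    have h3 : 0 ≤ 1 / η * (η * |b| - |a - b|) ^ 2 := by positivity
    linarith
  have h3 : |a ^ 2 - b ^ 2| ≤ 2 * |b| * |a - b| + (a - b) ^ 2 := by
    rw [show a ^ 2 - b ^ 2 = 2 * b * (a - b) + (a - b) ^ 2 by ring]
    refine (abs_add_le _ _).trans ?_
    rw [abs_mul, abs_mul, abs_two, abs_of_nonneg (sq_nonneg (a - b))]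
  have h4 : 1 / η * (a - b) ^ 2 ≤ 1 / η * K ^ 2 := by gcongr
  linarith

theorem abs_smoothness_sub_le {r s t : ℕ} {v : ℤ → ℝ} {η K : ℝ} (hη : 0 < η)
    (h : ∀ l ≤ r, ∀ ξ ∈ Set.Icc (-(1 / 2) : ℝ) (1 / 2),
      |(derivative^[l] (subPoly r s v)).eval ξ - (derivative^[l] (subPoly r t v)).eval ξ| ≤ K) :
    |smoothness r s v - smoothness r t v|
      ≤ η * smoothness r t v + r * ((1 + 1 / η) * K ^ 2) := by
  rw [smoothness, smoothness, ← Finset.sum_sub_distrib, Finset.mul_sum]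
  have hint : ∀ p : ℝ[X], IntervalIntegrable (fun ξ => p.eval ξ ^ 2) MeasureTheory.volume
      (-(1 / 2) : ℝ) (1 / 2) := fun p => (p.continuous.pow 2).intervalIntegrable _ _
  have hterm : ∀ l ∈ Icc 1 (r - 1),
      |(∫ ξ in (-(1 / 2) : ℝ)..(1 / 2), ((derivative^[l] (subPoly r s v)).eval ξ) ^ 2)
        - ∫ ξ in (-(1 / 2) : ℝ)..(1 / 2), ((derivative^[l] (subPoly r t v)).eval ξ) ^ 2|
      ≤ η * (∫ ξ in (-(1 / 2) : ℝ)..(1 / 2), ((derivative^[l] (subPoly r t v)).eval ξ) ^ 2)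
        + (1 + 1 / η) * K ^ 2 := by
    intro l hl
    rw [← intervalIntegral.integral_sub (hint _) (hint _)]
    refine (intervalIntegral.abs_integral_le_integral_abs (by norm_num)).trans ?_
    have e : η * (∫ ξ in (-(1 / 2) : ℝ)..(1 / 2), ((derivative^[l] (subPoly r t v)).eval ξ) ^ 2)
        + (1 + 1 / η) * K ^ 2 = ∫ ξ in (-(1 / 2) : ℝ)..(1 / 2),
          (η * ((derivative^[l] (subPoly r t v)).eval ξ) ^ 2 + (1 + 1 / η) * K ^ 2) := by
      rw [intervalIntegral.integral_add ((hint _).const_mul _) (by simp),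
        intervalIntegral.integral_const_mul, intervalIntegral.integral_const]
      norm_num
    rw [e]
    refine intervalIntegral.integral_mono_on (by norm_num) ((hint _).sub (hint _)).abs
      (((hint _).const_mul _).add (by simp)) fun ξ hξ => ?_
    have := Finset.mem_Icc.1 hl
    exact abs_sq_sub_sq_le hη (h l (by omega) ξ hξ)
  refine (Finset.abs_sum_le_sum_abs _ _).trans ((Finset.sum_le_sum hterm).trans ?_)
  rw [Finset.sum_add_distrib, Finset.sum_const, Nat.card_Icc, nsmul_eq_mul]
  have h1 : ((r - 1 + 1 - 1 : ℕ) : ℝ) ≤ r := by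
    exact_mod_cast (by omega : r - 1 + 1 - 1 ≤ r)
  have h2 : 0 ≤ (1 + 1 / η) * K ^ 2 := by positivity
  linarith [mul_le_mul_of_nonneg_right h1 h2]

theorem le_smoothness {r s l : ℕ} {v : ℤ → ℝ} {c : ℝ} (hl : l ∈ Icc 1 (r - 1)) (hc : 0 ≤ c)
    (h : ∀ ξ ∈ Set.Icc (-(1 / 2) : ℝ) (1 / 2), c ≤ |(derivative^[l] (subPoly r s v)).eval ξ|) :
    c ^ 2 ≤ smoothness r s v := by
  have h1 : c ^ 2
      ≤ ∫ ξ in (-(1 / 2) : ℝ)..(1 / 2), ((derivative^[l] (subPoly r s v)).eval ξ) ^ 2 := by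
    have e : c ^ 2 = ∫ _ξ in (-(1 / 2) : ℝ)..(1 / 2), c ^ 2 := by
      rw [intervalIntegral.integral_const]; norm_num
    rw [e]
    refine intervalIntegral.integral_mono_on (by norm_num) (by simp)
      (((derivative^[l] (subPoly r s v)).continuous.pow 2).intervalIntegrable _ _) fun ξ hξ => ?_
    rw [← sq_abs (eval _ _)]
    exact pow_le_pow_left₀ hc (h ξ hξ) 2
  exact h1.trans (Finset.single_le_sum (f := fun l => ∫ ξ in (-(1 / 2) : ℝ)..(1 / 2),
    ((derivative^[l] (subPoly r s v)).eval ξ) ^ 2)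
    (fun _ _ => intervalIntegral.integral_nonneg (by norm_num) fun _ _ => sq_nonneg _) hl)

/-! ### The reconstruction of a smooth function -/

/-- A polynomial of degree `< r` is its own reconstruction, so stability bounds the distance to it.
All substencils lie in `[-r, r]`, which allows a single constant. -/
theorem exists_subPoly_approx (r : ℕ) :
    ∃ B : ℝ, 0 ≤ B ∧ ∀ s < r, ∀ l ≤ r, ∀ φ : ℝ → ℝ, ∀ T : ℝ[X], ∀ D : ℝ,
      ContinuousOn φ (Set.Icc (-(r : ℝ)) r) → T.natDegree < r →
      (∀ ξ ∈ Set.Icc (-(r : ℝ)) r, |φ ξ - T.eval ξ| ≤ D) → 0 ≤ D →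
      ∀ ξ ∈ Set.Icc (-(1 / 2) : ℝ) (1 / 2),
        |(derivative^[l] (subPoly r s (unitAvg φ))).eval ξ - (derivative^[l] T).eval ξ|
          ≤ B * D := by
  have key : ∀ s : ℕ, ∃ B : ℝ, 0 ≤ B ∧ (s < r → ∀ l ≤ r, ∀ φ : ℝ → ℝ, ∀ T : ℝ[X], ∀ D : ℝ,
      ContinuousOn φ (Set.Icc (-(r : ℝ)) r) → T.natDegree < r →
      (∀ ξ ∈ Set.Icc (-(r : ℝ)) r, |φ ξ - T.eval ξ| ≤ D) → 0 ≤ D →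
      ∀ ξ ∈ Set.Icc (-(1 / 2) : ℝ) (1 / 2),
        |(derivative^[l] (subPoly r s (unitAvg φ))).eval ξ - (derivative^[l] T).eval ξ|
          ≤ B * D) := by
    intro s
    by_cases hs : s < r
    · have hs' : (s : ℝ) + 1 ≤ r := by exact_mod_cast hs
      have hs0 : (0 : ℝ) ≤ s := Nat.cast_nonneg s
      obtain ⟨B, hB0, hB⟩ := exists_reconPoly_approx ((s : ℤ) - ((r : ℤ) - 1)) r r r
        (by push_cast; linarith) (by push_cast; linarith)
      refine ⟨B, hB0, fun _ l hl φ T D hφ hT hD hD0 ξ hξ => ?_⟩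
      have := hB l hl φ T D hφ hD hD0 ξ hξ
      rwa [reconPoly_unitAvg _ _ T hT] at this
    · exact ⟨0, le_rfl, fun h => absurd h hs⟩
  choose B hB0 hB using key
  refine ⟨∑ s ∈ range r, B s, Finset.sum_nonneg fun s _ => hB0 s,
    fun s hs l hl φ T D hφ hT hD hD0 ξ hξ => ?_⟩
  refine (hB s hs l hl φ T D hφ hT hD hD0 ξ hξ).trans (mul_le_mul_of_nonneg_right ?_ hD0)
  exact Finset.single_le_sum (fun s _ => hB0 s) (Finset.mem_range.2 hs)

theorem half_mem_Icc : (1 / 2 : ℝ) ∈ Set.Icc (-(1 / 2) : ℝ) (1 / 2) := by norm_num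

/-- The powers of `t` are balanced here: relative discrepancy `t^p` of the indicators, weight error
`t^(p q) ≤ t^r`, and spread `t^r` of the substencil values. -/
theorem exists_mopRecon_sub_fullRecon_le {r n : ℕ} (hn : n + 2 ≤ r) (P : MAIMParams)
    (hA : 0 < P.A) (hδ : 0 < P.δ) (hεA : 0 < P.εA) (hm : ∀ s < r, 0 < P.m s)
    (hk : r ≤ maimOrder P.k * (r - 1 - n)) {w : ℝ → ℝ} {x₀ ρ M c : ℝ} (hρ : 0 < ρ) (hM : 0 ≤ M)
    (hw : HasBoundedDerivs w x₀ ρ M (2 * r)) (hc : 0 < c)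
    (hcrit : ∀ y ∈ Metric.ball x₀ ρ, c ≤ |iteratedDeriv (n + 1) w y|) :
    ∃ C h₀ : ℝ, 0 ≤ C ∧ 0 < h₀ ∧ ∀ y τ ε : ℝ, |y - x₀| < ρ / 2 → τ ≠ 0 → |τ| < h₀ → 0 < ε →
      |mopRecon r P ε (unitAvg fun ξ => w (y + τ * ξ))
        - fullRecon r (unitAvg fun ξ => w (y + τ * ξ))| ≤ C * |τ| ^ (2 * r) := by
  obtain ⟨B, hB0, hB⟩ := exists_subPoly_approx r
  obtain ⟨B', η₀, hB'0, hη₀, H⟩ := exists_mopRecon_sub_le (r := r) (by omega) P hA hδ hεA hm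
  have hr0 : (0 : ℝ) < r := by exact_mod_cast (by omega : 0 < r)
  set p := r - 1 - n with hp
  have hp1 : 1 ≤ p := by omega
  set q := maimOrder P.k
  set K₀ : ℝ := 2 * (B * (M * (r : ℝ) ^ r)) with hK₀
  set A : ℝ := 8 * r * K₀ ^ 2 / c ^ 2 with hA'
  have hA0 : 0 ≤ A := by positivity
  -- Below `h₁` the error in the derivative of order `n + 1` is at most half of its leading term.
  set h₁ : ℝ := c / 2 / (B * (M * (r : ℝ) ^ (n + 2)) + 1) with hh₁
  refine ⟨B' * (1 + A) ^ q * (B * (M * (r : ℝ) ^ r)),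
    min (min 1 (η₀ / (1 + A))) (min (ρ / (2 * r)) h₁), by positivity, by positivity,
    fun y τ ε hy hτ0 hτ hε => ?_⟩
  set t := |τ| with ht
  have ht0 : 0 < t := abs_pos.2 hτ0
  have ht1 : t ≤ 1 := (hτ.trans_le ((min_le_left _ _).trans (min_le_left _ _))).le
  have ht2 : t < η₀ / (1 + A) := hτ.trans_le ((min_le_left _ _).trans (min_le_right _ _))
  have ht3 : t < ρ / (2 * r) := hτ.trans_le ((min_le_right _ _).trans (min_le_left _ _))
  have ht4 : t < h₁ := hτ.trans_le ((min_le_right _ _).trans (min_le_right _ _))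
  rw [lt_div_iff₀ (by positivity)] at ht2 ht3 ht4
  have htr : t * r < ρ / 2 := by linarith
  set φ : ℝ → ℝ := fun ξ => w (y + τ * ξ) with hφ
  have hφc : ContinuousOn φ (Set.Icc (-(r : ℝ)) r) :=
    (hw.continuousOn (by omega)).comp (by fun_prop) fun ξ hξ => mem_ball_add_mul hy htr hξ
  have happrox : ∀ m, 0 < m → m ≤ r → ∀ s < r, ∀ l ≤ r, ∀ ξ ∈ Set.Icc (-(1 / 2) : ℝ) (1 / 2),
      |(derivative^[l] (subPoly r s (unitAvg φ))).eval ξ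
        - (derivative^[l] (unitTaylor w y τ m)).eval ξ| ≤ B * (M * (r : ℝ) ^ m * t ^ m) := by
    intro m hm0 hmr s hs l hl ξ hξ
    exact hB s hs l hl φ _ _ hφc ((natDegree_unitTaylor_lt w y τ hm0).trans_le hmr)
      (fun ξ hξ => hw.unitTaylor_sub_le hy hr0.le htr (by omega) hξ) (by positivity) ξ hξ
  have hy0 : y ∈ Metric.ball x₀ ρ := by
    rw [Metric.mem_ball, Real.dist_eq]; linarith
  -- The condition `n + 2 ≤ r` puts the order `n + 1` among the terms of the indicator and allows
  -- the Taylor polynomial with `n + 2` terms, whose derivative of that order is constant.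
  have hβ0 : (c / 2 * t ^ (n + 1)) ^ 2 ≤ smoothness r 0 (unitAvg φ) := by
    refine le_smoothness (l := n + 1) (Finset.mem_Icc.2 ⟨by omega, by omega⟩) (by positivity)
      fun ξ hξ => ?_
    have h1 := happrox (n + 2) (by omega) hn 0 (by omega) (n + 1) (by omega) ξ hξ
    rw [iterate_derivative_unitTaylor, eval_C] at h1
    have h2 : c * t ^ (n + 1) ≤ |iteratedDeriv (n + 1) w y * τ ^ (n + 1)| := by
      rw [abs_mul, abs_pow]
      exact mul_le_mul_of_nonneg_right (hcrit y hy0) (by positivity)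
    have h3 : B * (M * (r : ℝ) ^ (n + 2) * t ^ (n + 2)) ≤ c / 2 * t ^ (n + 1) := by
      calc B * (M * (r : ℝ) ^ (n + 2) * t ^ (n + 2))
          = (t * (B * (M * (r : ℝ) ^ (n + 2)))) * t ^ (n + 1) := by ring
        _ ≤ c / 2 * t ^ (n + 1) := by
          refine mul_le_mul_of_nonneg_right ?_ (by positivity)
          linarith
    have h4 := abs_sub_abs_le_abs_sub (iteratedDeriv (n + 1) w y * τ ^ (n + 1))
      (eval ξ (derivative^[n + 1] (subPoly r 0 (unitAvg φ))))
    rw [abs_sub_comm] at h4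
    linarith
  have hβ : ∀ s < r, |smoothness r s (unitAvg φ) - smoothness r 0 (unitAvg φ)|
      ≤ (1 + A) * t ^ p * smoothness r 0 (unitAvg φ) := by
    intro s hs
    have hη : 0 < t ^ p := by positivity
    refine (abs_smoothness_sub_le (η := t ^ p) (K := K₀ * t ^ r) hη fun l hl ξ hξ => ?_).trans ?_
    · have h1 := happrox r (by omega) le_rfl s hs l hl ξ hξ
      have h2 := happrox r (by omega) le_rfl 0 (by omega) l hl ξ hξ
      rw [abs_sub_comm] at h2
      refine (abs_sub_le _ _ _).trans ((add_le_add h1 h2).trans_eq ?_)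
      rw [hK₀]; ring
    · have h1 : 1 + 1 / t ^ p ≤ 2 / t ^ p := by
        have : 1 ≤ 1 / t ^ p := by
          rw [le_div_iff₀ hη, one_mul]; exact pow_le_one₀ ht0.le ht1
        have e : (2 : ℝ) / t ^ p = 1 / t ^ p + 1 / t ^ p := by ring
        linarith
      -- The identity `r = p + n + 1`, squared: one factor `t^p` absorbs `1 / η`, the other is the
      -- relative error. The constant `A` is what remains.
      have h2 : t ^ r * t ^ r = t ^ p * t ^ p * (t ^ (n + 1)) ^ 2 := by
        rw [← pow_mul, ← pow_add, ← pow_add, ← pow_add]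
        congr 1; omega
      have h3 : (r : ℝ) * ((1 + 1 / t ^ p) * (K₀ * t ^ r) ^ 2)
          ≤ A * t ^ p * (c / 2 * t ^ (n + 1)) ^ 2 := by
        calc (r : ℝ) * ((1 + 1 / t ^ p) * (K₀ * t ^ r) ^ 2)
            ≤ r * (2 / t ^ p * (K₀ * t ^ r) ^ 2) := by gcongr
          _ = r * (2 / t ^ p * (K₀ ^ 2 * (t ^ r * t ^ r))) := by ring
          _ = A * t ^ p * (c / 2 * t ^ (n + 1)) ^ 2 := by
            rw [h2, hA']; field_simp; ring
      have h4 : A * t ^ p * (c / 2 * t ^ (n + 1)) ^ 2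
          ≤ A * t ^ p * smoothness r 0 (unitAvg φ) := by gcongr
      linarith
  have hη : (1 + A) * t ^ p ≤ η₀ := by
    have : t ^ p ≤ t := by
      calc t ^ p ≤ t ^ 1 := pow_le_pow_of_le_one ht0.le ht1 hp1
        _ = t := pow_one _
    have h2 := mul_le_mul_of_nonneg_left this (by positivity : 0 ≤ 1 + A)
    linarith
  have hfin := H (unitAvg φ) ε ((1 + A) * t ^ p) ((unitTaylor w y τ r).eval (1 / 2))
    (B * (M * (r : ℝ) ^ r * t ^ r)) hε (by positivity) hη hβ fun s hs => by
      simpa [subRecon] using happrox r (by omega) le_rfl s hs 0 (by omega) (1 / 2) half_mem_Icc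
  refine hfin.trans ?_
  have h5 : (t ^ p) ^ q ≤ t ^ r := by
    rw [← pow_mul]
    exact pow_le_pow_of_le_one ht0.le ht1 (by rw [mul_comm]; exact hk)
  calc B' * ((1 + A) * t ^ p) ^ q * (B * (M * (r : ℝ) ^ r * t ^ r))
      = B' * (1 + A) ^ q * (B * (M * (r : ℝ) ^ r)) * ((t ^ p) ^ q * t ^ r) := by
        rw [mul_pow]; ring
    _ ≤ B' * (1 + A) ^ q * (B * (M * (r : ℝ) ^ r)) * (t ^ r * t ^ r) := by gcongr
    _ = _ := by rw [← pow_add, two_mul]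

/-- The leading error coefficient of the reconstruction on the full stencil. -/
noncomputable def fullErrorCoeff (r : ℕ) : ℝ :=
  fullRecon r (unitAvg fun ξ => (X ^ (2 * r - 1) : ℝ[X]).eval ξ) - (1 / 2) ^ (2 * r - 1)

/-- By linearity, the part of degree `< 2r - 1` is exact and only the top monomial leaves an error.
-/
theorem fullRecon_unitAvg {r : ℕ} (p : ℝ[X]) (hp : p.natDegree < 2 * r - 1) (a : ℝ) :
    fullRecon r (unitAvg fun ξ => (p + C a * X ^ (2 * r - 1)).eval ξ)
      = (p + C a * X ^ (2 * r - 1)).eval (1 / 2) + a * fullErrorCoeff r := by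
  obtain ⟨K, hK⟩ := exists_reconPoly_kernel (-((r : ℤ) - 1)) (2 * r - 1)
  have hlin : fullRecon r (unitAvg fun ξ => (p + C a * X ^ (2 * r - 1)).eval ξ)
      = fullRecon r (unitAvg fun ξ => p.eval ξ)
        + a * fullRecon r (unitAvg fun ξ => (X ^ (2 * r - 1) : ℝ[X]).eval ξ) := by
    have hu : ∀ i, unitAvg (fun ξ => (p + C a * X ^ (2 * r - 1)).eval ξ) i
        = unitAvg (fun ξ => p.eval ξ) i
          + a * unitAvg (fun ξ => (X ^ (2 * r - 1) : ℝ[X]).eval ξ) i := by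
      intro i
      simp only [unitAvg, eval_add, eval_mul, eval_C]
      rw [intervalIntegral.integral_add (p.continuous.intervalIntegrable _ _)
        (((X ^ (2 * r - 1) : ℝ[X]).continuous.intervalIntegrable _ _).const_mul _),
        intervalIntegral.integral_const_mul]
    simp only [fullRecon, hK, eval_finsetSum, eval_mul, eval_C, hu, Finset.mul_sum]
    rw [← Finset.sum_add_distrib]
    exact Finset.sum_congr rfl fun i _ => by ring
  have hex : fullRecon r (unitAvg fun ξ => p.eval ξ) = p.eval (1 / 2) := by
    rw [fullRecon, reconPoly_unitAvg _ _ p hp]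
  rw [hlin, hex, fullErrorCoeff]
  simp only [eval_add, eval_mul, eval_C, eval_pow, eval_X]
  ring

/-- Taylor's formula is pushed one degree beyond exactness so that the leading error is an explicit
Lipschitz function of `y`. A mere `O(t^(2r-1))` bound would lose an order in the flux difference. -/
theorem exists_fullRecon_expansion {r : ℕ} (hr : 2 ≤ r) {w : ℝ → ℝ} {x₀ ρ M : ℝ} (hρ : 0 < ρ)
    (hM : 0 ≤ M) (hw : HasBoundedDerivs w x₀ ρ M (2 * r)) :
    ∃ C h₀ Λ : ℝ, 0 ≤ C ∧ 0 < h₀ ∧ ∀ y τ : ℝ, |y - x₀| < ρ / 2 → |τ| < h₀ →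
      |fullRecon r (unitAvg fun ξ => w (y + τ * ξ)) - w (y + τ / 2)
        - Λ * iteratedDeriv (2 * r - 1) w y * τ ^ (2 * r - 1)| ≤ C * |τ| ^ (2 * r) := by
  have hr0 : (2 : ℝ) ≤ r := by exact_mod_cast hr
  obtain ⟨B, hB0, hB⟩ := exists_reconPoly_approx (-((r : ℤ) - 1)) (2 * r - 1) 0 r
    (by push_cast; linarith)
    (by rw [Nat.cast_sub (by omega)]; push_cast; linarith)
  refine ⟨(B + 1) * (M * (r : ℝ) ^ (2 * r)), ρ / (2 * r),
    fullErrorCoeff r / ((2 * r - 1).factorial : ℝ), by positivity, by positivity,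
    fun y τ hy hτ => ?_⟩
  rw [lt_div_iff₀ (by positivity)] at hτ
  have htr : |τ| * r < ρ / 2 := by linarith
  set φ : ℝ → ℝ := fun ξ => w (y + τ * ξ) with hφ
  have hφc : ContinuousOn φ (Set.Icc (-(r : ℝ)) r) :=
    (hw.continuousOn (by omega)).comp (by fun_prop) fun ξ hξ => mem_ball_add_mul hy htr hξ
  have hT : ∀ ξ ∈ Set.Icc (-(r : ℝ)) r, |φ ξ - (unitTaylor w y τ (2 * r)).eval ξ|
      ≤ M * (r : ℝ) ^ (2 * r) * |τ| ^ (2 * r) :=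
    fun ξ hξ => hw.unitTaylor_sub_le hy (by positivity) htr le_rfl hξ
  have h1 := hB 0 le_rfl φ _ _ hφc hT (by positivity) (1 / 2) half_mem_Icc
  rw [Function.iterate_zero, id, id, ← fullRecon, ← fullRecon] at h1
  have hsplit : unitTaylor w y τ (2 * r) = unitTaylor w y τ (2 * r - 1)
      + C (iteratedDeriv (2 * r - 1) w y / ((2 * r - 1).factorial : ℝ) * τ ^ (2 * r - 1))
        * X ^ (2 * r - 1) := by
    conv_lhs => rw [show 2 * r = 2 * r - 1 + 1 by omega, unitTaylor, Finset.sum_range_succ]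
    rfl
  have h2 : fullRecon r (unitAvg fun ξ => (unitTaylor w y τ (2 * r)).eval ξ)
      = (unitTaylor w y τ (2 * r)).eval (1 / 2)
        + iteratedDeriv (2 * r - 1) w y / ((2 * r - 1).factorial : ℝ) * τ ^ (2 * r - 1)
          * fullErrorCoeff r := by
    rw [hsplit]
    exact fullRecon_unitAvg _ (natDegree_unitTaylor_lt w y τ (by omega)) _
  have h3 := hT (1 / 2) ⟨by linarith, by linarith⟩
  rw [h2] at h1
  rw [hφ] at h3
  simp only at h3
  rw [show y + τ * (1 / 2) = y + τ / 2 by ring, abs_sub_comm] at h3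
  have e : fullRecon r (unitAvg φ) - w (y + τ / 2)
        - fullErrorCoeff r / ((2 * r - 1).factorial : ℝ) * iteratedDeriv (2 * r - 1) w y
          * τ ^ (2 * r - 1)
      = (fullRecon r (unitAvg φ) - ((unitTaylor w y τ (2 * r)).eval (1 / 2)
        + iteratedDeriv (2 * r - 1) w y / ((2 * r - 1).factorial : ℝ) * τ ^ (2 * r - 1)
          * fullErrorCoeff r)) + ((unitTaylor w y τ (2 * r)).eval (1 / 2) - w (y + τ / 2)) := by
    ring
  rw [e]
  refine (abs_add_le _ _).trans ((add_le_add h1 h3).trans_eq ?_)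
  ring

/-- The error of the nonlinear reconstruction is of order `2r - 1`, and it varies by one order
less from one cell to the next one. -/
theorem exists_mopRecon_error_le {r n : ℕ} (hn : n + 2 ≤ r) (P : MAIMParams)
    (hA : 0 < P.A) (hδ : 0 < P.δ) (hεA : 0 < P.εA) (hm : ∀ s < r, 0 < P.m s)
    (hk : kMAIM r n ≤ (P.k : ℝ)) {w : ℝ → ℝ} {x₀ : ℝ}
    (hw : ContDiffAt ℝ ((2 * r : ℕ) : ℕ∞) w x₀) (hcrit : iteratedDeriv (n + 1) w x₀ ≠ 0) :
    ∃ C h₀ ρ : ℝ, 0 ≤ C ∧ 0 < h₀ ∧ 0 < ρ ∧ ∀ τ ε : ℝ, τ ≠ 0 → |τ| < h₀ → 0 < ε →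
      (∀ y, |y - x₀| < ρ →
        |mopRecon r P ε (unitAvg fun ξ => w (y + τ * ξ)) - w (y + τ / 2)|
          ≤ C * |τ| ^ (2 * r - 1)) ∧
      ∀ y y', |y - x₀| < ρ → |y' - x₀| < ρ → |y - y'| ≤ |τ| →
        |(mopRecon r P ε (unitAvg fun ξ => w (y + τ * ξ)) - w (y + τ / 2))
          - (mopRecon r P ε (unitAvg fun ξ => w (y' + τ * ξ)) - w (y' + τ / 2))|
          ≤ C * |τ| ^ (2 * r) := by
  obtain ⟨ρ₁, M, hρ₁, hM, hb₁⟩ := exists_hasBoundedDerivs hw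
  have hcont : ContinuousAt (iteratedDeriv (n + 1) w) x₀ :=
    (hb₁.1 (n + 1) (by omega) x₀ (Metric.mem_ball_self hρ₁)).continuousAt
  set c := |iteratedDeriv (n + 1) w x₀| / 2
  have hc : 0 < c := by have := abs_pos.2 hcrit; positivity
  obtain ⟨ρ₂, hρ₂, hcρ⟩ := Metric.eventually_nhds_iff.1
    (hcont.abs.eventually (lt_mem_nhds (show c < |iteratedDeriv (n + 1) w x₀| by
      have := abs_pos.2 hcrit; simp only [c]; linarith)))
  set ρ := min ρ₁ ρ₂
  have hρ : 0 < ρ := lt_min hρ₁ hρ₂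
  have hb : HasBoundedDerivs w x₀ ρ M (2 * r) := hb₁.mono (min_le_left _ _)
  obtain ⟨C₁, h₁, hC₁, hh₁, H₁⟩ := exists_mopRecon_sub_fullRecon_le hn P hA hδ hεA hm
    (le_maimOrder_mul hn hk) hρ hM hb hc fun y hy =>
      (hcρ (lt_of_lt_of_le hy (min_le_right _ _))).le
  obtain ⟨C₂, h₂, Λ, hC₂, hh₂, H₂⟩ := exists_fullRecon_expansion (by omega) hρ hM hb
  have hball : ∀ {y}, |y - x₀| < ρ / 2 → y ∈ Metric.ball x₀ ρ := fun h => by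
    rw [Metric.mem_ball, Real.dist_eq]; linarith
  refine ⟨2 * (C₁ + C₂) + |Λ| * M, min 1 (min h₁ h₂), ρ / 2, by positivity, by positivity,
    by positivity, fun τ ε hτ0 hτ hε => ?_⟩
  have ht0 : 0 < |τ| := abs_pos.2 hτ0
  have ht1 : |τ| ≤ 1 := (hτ.trans_le (min_le_left _ _)).le
  have hτ₁ : |τ| < h₁ := hτ.trans_le ((min_le_right _ _).trans (min_le_left _ _))
  have hτ₂ : |τ| < h₂ := hτ.trans_le ((min_le_right _ _).trans (min_le_right _ _))
  set E : ℝ → ℝ := fun y => mopRecon r P ε (unitAvg fun ξ => w (y + τ * ξ)) - w (y + τ / 2)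
  have hE : ∀ y, |y - x₀| < ρ / 2 →
      |E y - Λ * iteratedDeriv (2 * r - 1) w y * τ ^ (2 * r - 1)| ≤ (C₁ + C₂) * |τ| ^ (2 * r) := by
    intro y hy
    have e1 := H₁ y τ ε hy hτ0 hτ₁ hε
    have e2 := H₂ y τ hy hτ₂
    rw [add_mul]
    refine le_trans (le_of_eq ?_) ((abs_add_le _ _).trans (add_le_add e1 e2))
    congr 1
    simp only [E]; ring
  have hpow : |τ| ^ (2 * r) = |τ| ^ (2 * r - 1) * |τ| := by
    rw [← pow_succ]; congr 1; omega
  have hpow' : |τ| ^ (2 * r) ≤ |τ| ^ (2 * r - 1) := by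
    rw [hpow]; exact mul_le_of_le_one_right (by positivity) ht1
  refine ⟨fun y hy => ?_, fun y y' hy hy' hyy => ?_⟩
  · have e1 := hE y hy
    have e2 : |Λ * iteratedDeriv (2 * r - 1) w y * τ ^ (2 * r - 1)|
        ≤ |Λ| * M * |τ| ^ (2 * r - 1) := by
      rw [abs_mul, abs_mul, abs_pow]
      gcongr
      exact hb.2 _ (by omega) y (hball hy)
    have e3 : (C₁ + C₂) * |τ| ^ (2 * r) ≤ (C₁ + C₂) * |τ| ^ (2 * r - 1) := by gcongr
    have e4 : |E y| ≤ |E y - Λ * iteratedDeriv (2 * r - 1) w y * τ ^ (2 * r - 1)|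
        + |Λ * iteratedDeriv (2 * r - 1) w y * τ ^ (2 * r - 1)| := by
      simpa using abs_add_le (E y - Λ * iteratedDeriv (2 * r - 1) w y * τ ^ (2 * r - 1))
        (Λ * iteratedDeriv (2 * r - 1) w y * τ ^ (2 * r - 1))
    have e5 : 0 ≤ (C₁ + C₂) * |τ| ^ (2 * r - 1) := by positivity
    change |E y| ≤ _
    linarith
  · have e1 := hE y hy
    have e2 := hE y' hy'
    -- The leading terms at nearby centres differ by one more power of `|τ|`, through the bound on
    -- the derivative of order `2r`.
    have e3 : |Λ * iteratedDeriv (2 * r - 1) w y * τ ^ (2 * r - 1)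
        - Λ * iteratedDeriv (2 * r - 1) w y' * τ ^ (2 * r - 1)| ≤ |Λ| * M * |τ| ^ (2 * r) := by
      rw [← sub_mul, ← mul_sub, abs_mul, abs_mul, abs_pow, hpow]
      have : |iteratedDeriv (2 * r - 1) w y - iteratedDeriv (2 * r - 1) w y'| ≤ M * |τ| :=
        (hb.lipschitz (by omega) (hball hy') (hball hy)).trans (by gcongr)
      calc |Λ| * |iteratedDeriv (2 * r - 1) w y - iteratedDeriv (2 * r - 1) w y'|
            * |τ| ^ (2 * r - 1) ≤ |Λ| * (M * |τ|) * |τ| ^ (2 * r - 1) := by gcongr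
        _ = _ := by ring
    change |E y - E y'| ≤ _
    rw [abs_le] at *
    constructor <;> linarith [e1.1, e1.2, e2.1, e2.2, e3.1, e3.2]

/-! ### The scheme in the unit-cell coordinate -/

theorem uMinus_eq (r : ℕ) (P : MAIMParams) (ε : ℝ) (w : ℝ → ℝ) (x : ℝ) {h : ℝ} (hh : 0 < h) :
    uMinus r P ε w x h = mopRecon r P ε (unitAvg fun ξ => w (x + h * ξ)) := by
  rw [uMinus]
  congr 1
  funext i
  rw [cellAvg, unitAvg, intervalIntegral.integral_comp_add_mul _ hh.ne', smul_eq_mul, one_div]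
  congr 2 <;> ring

/-- Reflection in the interface is the left-biased procedure centred at `x + h` with step `-h`; the
two signs, from reversing the integral and from the Jacobian, cancel. -/
theorem uPlus_eq (r : ℕ) (P : MAIMParams) (ε : ℝ) (w : ℝ → ℝ) (x : ℝ) {h : ℝ} (hh : 0 < h) :
    uPlus r P ε w x h = mopRecon r P ε (unitAvg fun ξ => w (x + h + -h * ξ)) := by
  rw [uPlus]
  congr 1
  funext i
  rw [cellAvg, unitAvg, intervalIntegral.integral_comp_add_mul _ (neg_ne_zero.2 hh.ne'),
    smul_eq_mul, one_div, intervalIntegral.integral_symm, inv_neg, neg_mul, mul_neg]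
  congr 3 <;> ring

/-! ### The flux -/

/-- First change `e` into `e'` at fixed `b`, by the Lipschitz bound on `f`; then move `b` to `b'`,
where `z ↦ f (z + e') - f z` has derivative `O(|e'|)` by the Lipschitz bound on `f'`. -/
theorem exists_increment_sub_le {f : ℝ → ℝ} {b₀ : ℝ} (hf : ContDiffAt ℝ 2 f b₀) :
    ∃ σ L : ℝ, 0 < σ ∧ 0 ≤ L ∧ ∀ b b' e e' : ℝ, |b - b₀| < σ → |b' - b₀| < σ → |e| < σ → |e'| < σ →
      |(f (b + e) - f b) - (f (b' + e') - f b')| ≤ L * (|e - e'| + |e'| * |b - b'|) := by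
  obtain ⟨ρ, L, hρ, hL, hb⟩ := exists_hasBoundedDerivs (N := 2) (by exact_mod_cast hf)
  refine ⟨ρ / 2, L, by positivity, hL, fun b b' e e' h1 h2 h3 h4 => ?_⟩
  have hmem : ∀ {b e : ℝ}, |b - b₀| < ρ / 2 → |e| < ρ / 2 → b + e ∈ Metric.ball b₀ ρ := by
    intro b e hb he
    rw [Metric.mem_ball, Real.dist_eq, add_sub_right_comm]
    linarith [abs_add_le (b - b₀) e]
  have hmem0 : ∀ {b : ℝ}, |b - b₀| < ρ / 2 → b ∈ Metric.ball b₀ ρ := by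
    intro b hb
    rw [Metric.mem_ball, Real.dist_eq]; linarith
  have e1 : |f (b + e) - f (b + e')| ≤ L * |e - e'| := by
    simpa using hb.lipschitz (l := 0) (by norm_num) (hmem h1 h4) (hmem h1 h3)
  have hd : ∀ z ∈ Metric.ball b₀ (ρ / 2), HasDerivWithinAt (fun z => f (z + e') - f z)
      (iteratedDeriv 1 f (z + e') - iteratedDeriv 1 f z) (Metric.ball b₀ (ρ / 2)) z := by
    intro z hz
    rw [Metric.mem_ball, Real.dist_eq] at hz
    have d1 := hb.1 0 (by norm_num) (z + e') (hmem hz h4)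
    have d2 := hb.1 0 (by norm_num) z (hmem0 hz)
    rw [iteratedDeriv_zero, zero_add] at d1 d2
    exact ((d1.comp_add_const z e').sub d2).hasDerivWithinAt
  have e2 : |(f (b + e') - f b) - (f (b' + e') - f b')| ≤ L * |e'| * |b - b'| := by
    refine (convex_ball b₀ (ρ / 2)).norm_image_sub_le_of_norm_hasDerivWithin_le hd
      (fun z hz => ?_) (by simpa [Real.dist_eq] using h2) (by simpa [Real.dist_eq] using h1)
    rw [Metric.mem_ball, Real.dist_eq] at hz
    simpa using hb.lipschitz (l := 1) (by norm_num) (hmem0 hz) (hmem hz h4)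
  have e3 : (f (b + e) - f b) - (f (b' + e') - f b')
      = (f (b + e) - f (b + e')) + ((f (b + e') - f b) - (f (b' + e') - f b')) := by ring
  rw [e3]
  refine (abs_add_le _ _).trans ((add_le_add e1 e2).trans_eq ?_)
  ring

/-- Differentiate under the integral, replace the time derivative by `-∂ₓ f(u)` using the
conservation law, and integrate in space. -/
theorem exists_deriv_cellAvg_eq {f : ℝ → ℝ} {u : ℝ → ℝ → ℝ} {t₀ x₀ : ℝ}
    (hu : ContDiffAt ℝ 1 (fun p : ℝ × ℝ => u p.1 p.2) (t₀, x₀)) (hf : ContDiffAt ℝ 1 f (u t₀ x₀))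
    (hpde : ∀ᶠ p : ℝ × ℝ in 𝓝 (t₀, x₀),
      deriv (fun t => u t p.2) p.1 + deriv (fun x => f (u p.1 x)) p.2 = 0) :
    ∃ ρ : ℝ, 0 < ρ ∧ ∀ x h : ℝ, |x - x₀| < ρ → 0 < h → h < ρ →
      deriv (fun t => cellAvg (u t) x h) t₀
        = -(1 / h) * (f (u t₀ (x + h / 2)) - f (u t₀ (x - h / 2))) := by
  set U : ℝ × ℝ → ℝ := fun p => u p.1 p.2 with hU
  set F : ℝ × ℝ → ℝ := fun p => fderiv ℝ U p (1, 0) with hF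
  have hFc : ∀ p, ContDiffAt ℝ 1 U p → ContinuousAt F p := fun p hp =>
    ((hp.fderiv_right (m := 0) (by norm_num)).continuousAt).clm_apply continuousAt_const
  have h1 : ∀ᶠ p in 𝓝 (t₀, x₀), ContDiffAt ℝ 1 U p := hu.eventually (by simp)
  have h2 : ∀ᶠ p in 𝓝 (t₀, x₀), ContDiffAt ℝ 1 f (U p) :=
    (hu.continuousAt (n := 1)).eventually (hf.eventually (by simp))
  have h3 : ∀ᶠ p in 𝓝 (t₀, x₀), |F p| < |F (t₀, x₀)| + 1 :=
    (hFc _ hu).abs.eventually (gt_mem_nhds (by linarith))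
  obtain ⟨σ, hσ, H⟩ := Metric.eventually_nhds_iff.1 (h1.and (h2.and (h3.and hpde)))
  refine ⟨σ / 2, by positivity, fun x h hx hh0 hh => ?_⟩
  have hI : ∀ y ∈ Set.uIcc (x - h / 2) (x + h / 2), |y - x₀| < σ := by
    intro y hy
    rw [Set.uIcc_of_le (by linarith)] at hy
    rw [abs_lt] at hx ⊢
    exact ⟨by linarith [hy.1], by linarith [hy.2]⟩
  have hbox : ∀ t y, |t - t₀| < σ → |y - x₀| < σ → dist (t, y) (t₀, x₀) < σ := by
    intro t y ht hy
    rw [Prod.dist_eq]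
    exact max_lt ht hy
  have ht₀ : |t₀ - t₀| < σ := by simpa using hσ
  have hFcont : ContinuousOn (fun y => F (t₀, y)) (Set.uIcc (x - h / 2) (x + h / 2)) := by
    intro y hy
    have := hFc _ (H (hbox t₀ y ht₀ (hI y hy))).1
    exact (this.comp (f := fun y => (t₀, y)) (by fun_prop)).continuousWithinAt
  have hUcont : ∀ t, |t - t₀| < σ →
      ContinuousOn (u t) (Set.uIcc (x - h / 2) (x + h / 2)) := by
    intro t ht y hy
    have := (H (hbox t y ht (hI y hy))).1.continuousAt
    exact (this.comp (f := fun y => (t, y)) (by fun_prop)).continuousWithinAt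
  have hderiv : ∀ t y, |t - t₀| < σ → |y - x₀| < σ →
      HasDerivAt (fun t => u t y) (F (t, y)) t := by
    intro t y ht hy
    have hd := ((H (hbox t y ht hy)).1.differentiableAt (by norm_num)).hasFDerivAt
    exact hd.comp_hasDerivAt t ((hasDerivAt_id t).prodMk (hasDerivAt_const t y))
  have hmain := (intervalIntegral.hasDerivAt_integral_of_dominated_loc_of_deriv_le
    (μ := MeasureTheory.volume) (a := x - h / 2) (b := x + h / 2) (F := fun t y => u t y)
    (F' := fun t y => F (t, y)) (x₀ := t₀) (s := Metric.ball t₀ σ)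
    (bound := fun _ => |F (t₀, x₀)| + 1) (Metric.ball_mem_nhds _ hσ)
    (by
      filter_upwards [Metric.ball_mem_nhds t₀ hσ] with t ht
      exact ((hUcont t ht).mono Set.uIoc_subset_uIcc).aestronglyMeasurable
        measurableSet_uIoc)
    (hUcont t₀ ht₀).intervalIntegrable
    ((hFcont.mono Set.uIoc_subset_uIcc).aestronglyMeasurable measurableSet_uIoc)
    (Filter.Eventually.of_forall fun y hy t ht =>
      (H (hbox t y ht (hI y (Set.uIoc_subset_uIcc hy)))).2.2.1.le)
    (by simp)
    (Filter.Eventually.of_forall fun y hy t ht =>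
      hderiv t y ht (hI y (Set.uIoc_subset_uIcc hy)))).2
  have hspace : ∫ y in (x - h / 2)..(x + h / 2), -F (t₀, y)
      = f (u t₀ (x + h / 2)) - f (u t₀ (x - h / 2)) := by
    refine intervalIntegral.integral_eq_sub_of_hasDerivAt (f := fun y => f (u t₀ y))
      (fun y hy => ?_) hFcont.neg.intervalIntegrable
    obtain ⟨k1, k2, -, k4⟩ := H (hbox t₀ y ht₀ (hI y hy))
    have hux : DifferentiableAt ℝ (u t₀) y :=
      (k1.differentiableAt (by norm_num)).comp (f := fun y => (t₀, y)) y (by fun_prop)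
    have hfx : DifferentiableAt ℝ (fun y => f (u t₀ y)) y :=
      (k2.differentiableAt (by norm_num)).comp (f := u t₀) y hux
    have e : deriv (fun y => f (u t₀ y)) y = -F (t₀, y) := by
      have := (hderiv t₀ y ht₀ (hI y hy)).deriv
      simp only [this] at k4
      linarith
    rw [← e]
    exact hfx.hasDerivAt
  have := (hmain.const_mul (1 / h)).deriv
  simp only [cellAvg]
  rw [this, ← hspace, intervalIntegral.integral_neg]
  ring

end MOPWENO

/-! ### Accuracy of the semi-discrete scheme -/

theorem mainTheorem8 (r n : ℕ) (hn : (n : ℤ) < (r : ℤ) - 1)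
    -- the parameters of the mapping functions
    (P : MOPWENO.MAIMParams) (hA : 0 < P.A) (hδ : 0 < P.δ) (hεA : 0 < P.εA)
    (hm : ∀ s < r, 0 < P.m s) (hk : MOPWENO.kMAIM r n ≤ (P.k : ℝ))
    -- the flux, the viscosity constant, and a smooth solution of the conservation law near a point
    (f : ℝ → ℝ) (α : ℝ) (u : ℝ → ℝ → ℝ) (t₀ x₀ : ℝ)
    (hu : ContDiffAt ℝ (⊤ : ℕ∞) (fun p : ℝ × ℝ => u p.1 p.2) (t₀, x₀))
    (hf : ContDiffAt ℝ 2 f (u t₀ x₀))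
    (hpde : ∀ᶠ p : ℝ × ℝ in 𝓝 (t₀, x₀),
      deriv (fun t => u t p.2) p.1 + deriv (fun x => f (u p.1 x)) p.2 = 0)
    (hcrit : MOPWENO.IsCriticalPointOfOrder n (u t₀) x₀) :
    ∃ C h₀ ρ : ℝ, 0 < h₀ ∧ 0 < ρ ∧
      ∀ x h ε : ℝ, |x - x₀| < ρ → 0 < h → h < h₀ → 0 < ε →
        |MOPWENO.uMinus r P ε (u t₀) x h - u t₀ (x + h / 2)| ≤ C * h ^ (2 * r - 1) ∧
        |MOPWENO.uPlus r P ε (u t₀) x h - u t₀ (x + h / 2)| ≤ C * h ^ (2 * r - 1) ∧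
        |deriv (fun t => MOPWENO.cellAvg (u t) x h) t₀
            - MOPWENO.spatialOp r P ε f α (u t₀) x h| ≤ C * h ^ (2 * r - 1) := by
  open MOPWENO in
  set w := u t₀ with hw
  have hwC : ∀ N : ℕ, ContDiffAt ℝ ((N : ℕ) : ℕ∞) w x₀ := fun N =>
    ContDiffAt.comp (f := fun y : ℝ => (t₀, y)) x₀
      (hu.of_le (by exact_mod_cast (le_top : ((N : ℕ) : ℕ∞) ≤ ⊤))) (by fun_prop)
  obtain ⟨C, h₁, ρ₁, hC, hh₁, hρ₁, hrec⟩ := exists_mopRecon_error_le (by omega) P hA hδ hεA hm hk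
    (hwC (2 * r)) hcrit.2
  obtain ⟨σ, L, hσ, hL, hflux⟩ := exists_increment_sub_le hf
  obtain ⟨ρ₂, hρ₂, htime⟩ := exists_deriv_cellAvg_eq
    (hu.of_le (by exact_mod_cast (le_top : ((1 : ℕ) : ℕ∞) ≤ ⊤))) (hf.of_le (by norm_num)) hpde
  obtain ⟨ρ₃, M, hρ₃, hM, hb⟩ := exists_hasBoundedDerivs (hwC 1)
  obtain ⟨ρ₄, hρ₄, hwσ⟩ := Metric.eventually_nhds_iff.1
    ((hwC 0).continuousAt.eventually (Metric.ball_mem_nhds _ hσ))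
  set ρ := min (min ρ₁ ρ₂) (min ρ₃ ρ₄)
  have hρ : 0 < ρ := by positivity
  have hρ1 : ρ ≤ ρ₁ := (min_le_left _ _).trans (min_le_left _ _)
  have hρ2 : ρ ≤ ρ₂ := (min_le_left _ _).trans (min_le_right _ _)
  have hρ3 : ρ ≤ ρ₃ := (min_le_right _ _).trans (min_le_left _ _)
  have hρ4 : ρ ≤ ρ₄ := (min_le_right _ _).trans (min_le_right _ _)
  -- The bound `σ / (C + 1)` keeps the reconstruction errors within the range of the flux estimate;
  -- `ρ / 2` keeps the neighbouring centres and both interfaces in the good neighbourhood.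
  refine ⟨C + (L * (C + C * M) + |α| * C), min (min h₁ 1) (min (σ / (C + 1)) (ρ / 2)), ρ / 2,
    by positivity, by positivity, fun x h ε hx hh0 hh hε => ?_⟩
  have hh1 : h < h₁ := hh.trans_le ((min_le_left _ _).trans (min_le_left _ _))
  have hh2 : h < 1 := hh.trans_le ((min_le_left _ _).trans (min_le_right _ _))
  have hh3 : h < σ / (C + 1) := hh.trans_le ((min_le_right _ _).trans (min_le_left _ _))
  have hh4 : h < ρ / 2 := hh.trans_le ((min_le_right _ _).trans (min_le_right _ _))
  rw [lt_div_iff₀ (by positivity)] at hh3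
  have hnear : ∀ z, |z - x| ≤ h → |z - x₀| < ρ := fun z hz => by
    linarith [abs_sub_le z x x₀]
  have n0 : |x - x₀| < ρ := by linarith
  have n1 : |x - h - x₀| < ρ := hnear _ (by simp [abs_of_pos hh0])
  have n2 : |x + h - x₀| < ρ := hnear _ (by simp [abs_of_pos hh0])
  have n3 : |x + h / 2 - x₀| < ρ := hnear _ (by
    rw [add_sub_cancel_left, abs_of_pos (by linarith)]; linarith)
  have n4 : |x - h / 2 - x₀| < ρ := hnear _ (by
    rw [sub_sub_cancel_left, abs_neg, abs_of_pos (by linarith)]; linarith)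
  obtain ⟨a1, a2⟩ := hrec h ε hh0.ne' (by rwa [abs_of_pos hh0]) hε
  obtain ⟨b1, b2⟩ := hrec (-h) ε (neg_ne_zero.2 hh0.ne') (by rwa [abs_neg, abs_of_pos hh0]) hε
  rw [abs_neg] at b1 b2
  rw [abs_of_pos hh0] at a1 a2 b1 b2
  -- the errors of the four one-sided values
  set e₁ := uMinus r P ε w x h - w (x + h / 2) with he₁
  set e₁' := uMinus r P ε w (x - h) h - w (x - h / 2) with he₁'
  set e₂ := uPlus r P ε w x h - w (x + h / 2) with he₂
  set e₂' := uPlus r P ε w (x - h) h - w (x - h / 2) with he₂'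
  have E1 : mopRecon r P ε (unitAvg fun ξ => w (x + h * ξ)) - w (x + h / 2) = e₁ := by
    rw [he₁, uMinus_eq _ _ _ _ _ hh0]
  have E1' : mopRecon r P ε (unitAvg fun ξ => w (x - h + h * ξ)) - w (x - h + h / 2) = e₁' := by
    rw [he₁', uMinus_eq _ _ _ _ _ hh0, show x - h + h / 2 = x - h / 2 by ring]
  have E2 : mopRecon r P ε (unitAvg fun ξ => w (x + h + -h * ξ)) - w (x + h + -h / 2) = e₂ := by
    rw [he₂, uPlus_eq _ _ _ _ _ hh0, show x + h + -h / 2 = x + h / 2 by ring]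
  have E2' : mopRecon r P ε (unitAvg fun ξ => w (x + -h * ξ)) - w (x + -h / 2) = e₂' := by
    rw [he₂', uPlus_eq _ _ _ _ _ hh0, show x + -h / 2 = x - h / 2 by ring, sub_add_cancel]
  have c1 : |e₁| ≤ C * h ^ (2 * r - 1) := E1 ▸ a1 x (n0.trans_le hρ1)
  have c1' : |e₁'| ≤ C * h ^ (2 * r - 1) := E1' ▸ a1 (x - h) (n1.trans_le hρ1)
  have c2 : |e₂| ≤ C * h ^ (2 * r - 1) := E2 ▸ b1 (x + h) (n2.trans_le hρ1)
  have c2' : |e₂'| ≤ C * h ^ (2 * r - 1) := E2' ▸ b1 x (n0.trans_le hρ1)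
  have d1 : |e₁ - e₁'| ≤ C * h ^ (2 * r) := by
    have := a2 x (x - h) (n0.trans_le hρ1) (n1.trans_le hρ1) (by simp [abs_of_pos hh0])
    rwa [E1, E1'] at this
  have d2 : |e₂ - e₂'| ≤ C * h ^ (2 * r) := by
    have := b2 (x + h) x (n2.trans_le hρ1) (n0.trans_le hρ1) (by simp [abs_of_pos hh0])
    rwa [E2, E2'] at this
  have hpos : 0 < h ^ (2 * r - 1) := by positivity
  have hCle : C * h ^ (2 * r - 1)
      ≤ (C + (L * (C + C * M) + |α| * C)) * h ^ (2 * r - 1) := by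
    have : 0 ≤ L * (C + C * M) + |α| * C := by positivity
    gcongr
    linarith
  refine ⟨c1.trans hCle, c2.trans hCle, ?_⟩
  have hsmall : C * h ^ (2 * r - 1) < σ := by
    have : h ^ (2 * r - 1) ≤ h := by
      calc h ^ (2 * r - 1) ≤ h ^ 1 := pow_le_pow_of_le_one hh0.le hh2.le (by omega)
        _ = h := pow_one _
    nlinarith
  have hpow : h ^ (2 * r) = h ^ (2 * r - 1) * h := by
    rw [← pow_succ]; congr 1; omega
  set b := w (x + h / 2) with hbdef
  set b' := w (x - h / 2) with hbdef'
  have hbσ : |b - u t₀ x₀| < σ := hwσ (n3.trans_le hρ4)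
  have hbσ' : |b' - u t₀ x₀| < σ := hwσ (n4.trans_le hρ4)
  have hbb : |b - b'| ≤ M * h := by
    have := hb.lipschitz (l := 0) one_pos (y := x - h / 2) (z := x + h / 2)
      (n4.trans_le hρ3) (n3.trans_le hρ3)
    rw [iteratedDeriv_zero, show x + h / 2 - (x - h / 2) = h by ring, abs_of_pos hh0] at this
    exact this
  have hinc : ∀ e e', |e| ≤ C * h ^ (2 * r - 1) → |e'| ≤ C * h ^ (2 * r - 1) →
      |e - e'| ≤ C * h ^ (2 * r) →
      |(f (b + e) - f b) - (f (b' + e') - f b')| ≤ L * (C + C * M) * h ^ (2 * r) := by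
    intro e e' k1 k2 k3
    refine (hflux b b' e e' hbσ hbσ' (k1.trans_lt hsmall) (k2.trans_lt hsmall)).trans ?_
    have k4 : |e'| * |b - b'| ≤ C * h ^ (2 * r - 1) * (M * h) := by gcongr
    calc L * (|e - e'| + |e'| * |b - b'|)
        ≤ L * (C * h ^ (2 * r) + C * h ^ (2 * r - 1) * (M * h)) := by gcongr
      _ = _ := by rw [hpow]; ring
  have i1 := hinc e₁ e₁' c1 c1' d1
  have i2 := hinc e₂ e₂' c2 c2' d2
  -- The exact fluxes `f b` and `f b'` are split off, and the viscosity sees only errors because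
  -- `u^-` and `u^+` approximate the same value. What remains are differences of errors across the
  -- cell, each `O(h^(2r))`.
  have e3 : deriv (fun t => cellAvg (u t) x h) t₀ - spatialOp r P ε f α w x h
      = 1 / h * (1 / 2 * (((f (b + e₁) - f b) - (f (b' + e₁') - f b'))
        + ((f (b + e₂) - f b) - (f (b' + e₂') - f b')) - α * ((e₂ - e₂') - (e₁ - e₁')))) := by
    rw [htime x h (n0.trans_le hρ2) hh0 (by linarith), spatialOp, numFlux, numFlux, lfFlux, lfFlux,
      ← hw, ← hbdef, ← hbdef', show uMinus r P ε w x h = b + e₁ by rw [he₁]; ring,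
      show uMinus r P ε w (x - h) h = b' + e₁' by rw [he₁']; ring,
      show uPlus r P ε w x h = b + e₂ by rw [he₂]; ring,
      show uPlus r P ε w (x - h) h = b' + e₂' by rw [he₂']; ring]
    ring
  have e4 : |α * ((e₂ - e₂') - (e₁ - e₁'))| ≤ |α| * (2 * (C * h ^ (2 * r))) := by
    rw [abs_mul]
    gcongr
    refine (abs_sub _ _).trans ?_
    linarith
  rw [e3, abs_mul, abs_of_pos (by positivity : 0 < 1 / h), one_div, ← div_eq_inv_mul,
    div_le_iff₀ hh0, mul_assoc, ← hpow, abs_mul, abs_of_pos (by norm_num : (0 : ℝ) < 1 / 2)]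
  have e5 := abs_sub ((f (b + e₁) - f b) - (f (b' + e₁') - f b')
        + ((f (b + e₂) - f b) - (f (b' + e₂') - f b'))) (α * ((e₂ - e₂') - (e₁ - e₁')))
  have e6 := abs_add_le ((f (b + e₁) - f b) - (f (b' + e₁') - f b'))
    ((f (b + e₂) - f b) - (f (b' + e₂') - f b'))
  have e7 : 0 ≤ C * h ^ (2 * r) := by positivity
  linarith
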